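/- An algebra over $\mathbb C$ is a complex vector space with a bilinear product, not assumed associative. For elements of an algebra put $J(a,b,c)=(ab)c+(bc)a+(ca)b$. An anticommutative algebra is called a Tortkara algebra if $(ab)(cb)=J(a,b,c)b$ for all $a,b,c$, and a Malcev algebra if $J(x,y,xz)=J(x,y,z)x$ for all $x,y,z$. An algebra is nilpotent if for some $n\ge 1$ all products of $n$ elements, with any arrangement of brackets, vanish. Consider the following anticommutative algebras with basis $e_1,\dots,e_6$ over $\mathbb C$, where $\alpha\in\mathbb C$ and where the products $e_ie_j$ with $i<j$ that are not listed are zero: - $\mathbb T^6_{00}$: $e_1e_2=e_3,\ e_1e_3=e_4,\ e_2e_4=e_5$; - $\mathbb T^6_{01}$: $e_1e_2=e_3,\ e_1e_3=e_4,\ e_1e_4=e_5,\ e_2e_3=e_5,\ e_2e_4=e_6$; - $\mathbb T^6_{02}$: $e_1e_2=e_3,\ e_1e_3=e_4,\ e_2e_3=e_5,\ e_2e_4=e_6$; - $\mathbb T^6_{03}$: $e_1e_2=e_3,\ e_1e_3=e_4,\ e_1e_4=e_5,\ e_2e_4=e_6$; - $\mathbb T^6_{04}$: $e_1e_2=e_3,\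 e_1e_3=e_4,\ e_1e_5=e_6,\ e_2e_4=e_6$; - $\mathbb T^6_{05}$: $e_1e_2=e_3,\ e_1e_3=e_4,\ e_2e_3=e_6,\ e_4e_5=e_6$; - $\mathbb T^6_{06}$: $e_1e_2=e_3,\ e_1e_3=e_4,\ e_2e_4=e_6,\ e_3e_5=e_6$; - $\mathbb T^6_{07}$: $e_1e_2=e_3,\ e_1e_3=e_4,\ e_4e_5=e_6$; - $\mathbb T^6_{08}$: $e_1e_2=e_3,\ e_1e_3=e_4,\ e_1e_4=e_6,\ e_1e_5=-e_6,\ e_2e_3=e_5,\ e_2e_4=e_6$; - $\mathbb T^6_{09}(\alpha)$: $e_1e_2=e_3,\ e_1e_3=e_4,\ e_1e_5=(\alpha+1)e_6,\ e_2e_3=e_5,\ e_2e_4=\alpha e_6$; - $\mathbb T^6_{10}$: $e_1e_2=e_3,\ e_1e_3=e_6,\ e_1e_4=e_5,\ e_2e_3=e_5,\ e_4e_5=e_6$; - $\mathbb T^6_{11}$: $e_1e_2=e_3,\ e_1e_4=e_5,\ e_1e_5=e_6,\ e_2e_3=e_5$; - $\mathbb T^6_{12}$: $e_1e_2=e_3,\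 e_1e_4=e_5,\ e_1e_5=e_6,\ e_2e_3=e_5,\ e_2e_4=e_6$; - $\mathbb T^6_{13}$: $e_1e_2=e_3,\ e_1e_4=e_5,\ e_1e_5=e_6,\ e_2e_3=e_5,\ e_3e_4=e_6$; - $\mathbb T^6_{14}$: $e_1e_2=e_3,\ e_1e_4=e_5,\ e_2e_3=e_5,\ e_4e_5=e_6$; - $\mathbb T^6_{15}$: $e_1e_2=e_3,\ e_1e_3=e_4,\ e_1e_4=e_5,\ e_1e_5=e_6,\ e_2e_4=e_6$; - $\mathbb T^6_{16}$: $e_1e_2=e_3,\ e_1e_3=e_4,\ e_1e_4=e_5,\ e_2e_5=e_6$; - $\mathbb T^6_{17}$: $e_1e_2=e_3,\ e_1e_3=e_4,\ e_1e_4=e_5,\ e_2e_3=e_5,\ e_2e_5=e_6$; - $\mathbb T^6_{18}(\alpha)$: $e_1e_2=e_3,\ e_1e_3=e_4,\ e_1e_4=e_5,\ e_1e_5=(\alpha+1)e_6,\ e_2e_3=e_5,\ e_2e_4=\alpha e_6$; - $\mathbb T^6_{19}$: $e_1e_2=e_3,\ e_1e_3=e_4,\ e_1e_5=e_6,\ e_2e_4=e_5,\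 e_3e_4=e_6$. **Theorem.** All these algebras are nilpotent Tortkara algebras and none of them is a Malcev algebra. Conversely, every $6$-dimensional nilpotent Tortkara algebra over $\mathbb C$ that is not a Malcev algebra is isomorphic to one of $\mathbb T^6_{00},\dots,\mathbb T^6_{19}$, where the parameter can be taken with $\alpha\notin\{0,-1\}$ in $\mathbb T^6_{09}(\alpha)$ and with $\alpha\ne-1$ in $\mathbb T^6_{18}(\alpha)$. With these restrictions on the parameters, the listed algebras are pairwise non-isomorphic, except that $\mathbb T^6_{09}(\alpha)\cong\mathbb T^6_{09}(-\alpha-1)$. At the excluded values one has $\mathbb T^6_{09}(0)\cong\mathbb T^6_{09}(-1)\cong\mathbb T^6_{02}$ and $\mathbb T^6_{18}(-1)\cong\mathbb T^6_{01}$. -/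

import Mathlib

namespace Tortkara

/-- A (not necessarily associative) algebra over `ℂ` is a complex vector space `V` together with a
bilinear product `V →ₗ[ℂ] V →ₗ[ℂ] V`. -/
abbrev Product (V : Type*) [AddCommGroup V] [Module ℂ V] : Type _ := V →ₗ[ℂ] V →ₗ[ℂ] V

section Algebras

variable {V : Type*} [AddCommGroup V] [Module ℂ V]
variable {W : Type*} [AddCommGroup W] [Module ℂ W]

def IsAnticommutative (μ : Product V) : Prop :=
  ∀ x y, μ x y = -μ y x

/-- `J(a, b, c) = (ab)c + (bc)a + (ca)b`. -/
def jacobian (μ : Product V) (a b c : V) : V :=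
  μ (μ a b) c + μ (μ b c) a + μ (μ c a) b

/-- Tortkara algebras: anticommutative, with `(ab)(cb) = J(a, b, c) b`. -/
def IsTortkara (μ : Product V) : Prop :=
  IsAnticommutative μ ∧ ∀ a b c, μ (μ a b) (μ c b) = μ (jacobian μ a b c) b

/-- Malcev algebras: anticommutative, with `J(x, y, xz) = J(x, y, z) x`. -/
def IsMalcev (μ : Product V) : Prop :=
  IsAnticommutative μ ∧ ∀ x y z, jacobian μ x y (μ x z) = μ (jacobian μ x y z) x

/-- `IsProductOf μ n v`: the vector `v` is a product of `n` elements of the algebra, with some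
arrangement of brackets. -/
inductive IsProductOf (μ : Product V) : ℕ → V → Prop
  | single (x : V) : IsProductOf μ 1 x
  | mul {m n : ℕ} {x y : V} :
      IsProductOf μ m x → IsProductOf μ n y → IsProductOf μ (m + n) (μ x y)

/-- An algebra is nilpotent if, for some `n ≥ 1`, all products of `n` elements vanish, whatever the
arrangement of brackets. -/
def IsNilpotent (μ : Product V) : Prop :=
  ∃ n : ℕ, 1 ≤ n ∧ ∀ v, IsProductOf μ n v → v = 0

/-- Isomorphism of algebras: a linear bijection that respects the products. -/
def Isomorphic (μ : Product V) (ν : Product W) : Prop :=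
  ∃ φ : V ≃ₗ[ℂ] W, ∀ x y, φ (μ x y) = ν (φ x) (φ y)

end Algebras

/-- The standard basis of `ℂ⁶`, indexed from `0`: the vector usually called `e₁` is `e 0`, …, the
vector usually called `e₆` is `e 5`. -/
def e (i : Fin 6) : Fin 6 → ℂ := Pi.single i 1

/-- The anticommutative product on `ℂ⁶` whose only nonzero products of basis vectors are
`(e i)(e j) = v` and `(e j)(e i) = -v` (for `i ≠ j`). -/
def elementary (i j : Fin 6) (v : Fin 6 → ℂ) : Product (Fin 6 → ℂ) :=
  LinearMap.mk₂ ℂ (fun x y => (x i * y j - x j * y i) • v)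
    (fun x x' y => by rw [← add_smul]; congr 1; simp only [Pi.add_apply]; ring)
    (fun c x y => by rw [smul_smul]; congr 1; simp only [Pi.smul_apply, smul_eq_mul]; ring)
    (fun x y y' => by rw [← add_smul]; congr 1; simp only [Pi.add_apply]; ring)
    (fun c x y => by rw [smul_smul]; congr 1; simp only [Pi.smul_apply, smul_eq_mul]; ring)

/-- The names of the algebras of the classification; two of them carry a parameter. -/
inductive Name : Type
  | T00 | T01 | T02 | T03 | T04 | T05 | T06 | T07 | T08
  | T09 (α : ℂ)
  | T10 | T11 | T12 | T13 | T14 | T15 | T16 | T17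
  | T18 (α : ℂ)
  | T19

/-- The multiplication tables. An entry `(i, j, v)` means `(e i)(e j) = v`. -/
def Name.table : Name → List (Fin 6 × Fin 6 × (Fin 6 → ℂ))
  -- e₁e₂ = e₃, e₁e₃ = e₄, e₂e₄ = e₅
  | .T00 => [(0, 1, e 2), (0, 2, e 3), (1, 3, e 4)]
  -- e₁e₂ = e₃, e₁e₃ = e₄, e₁e₄ = e₅, e₂e₃ = e₅, e₂e₄ = e₆
  | .T01 => [(0, 1, e 2), (0, 2, e 3), (0, 3, e 4), (1, 2, e 4), (1, 3, e 5)]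
  -- e₁e₂ = e₃, e₁e₃ = e₄, e₂e₃ = e₅, e₂e₄ = e₆
  | .T02 => [(0, 1, e 2), (0, 2, e 3), (1, 2, e 4), (1, 3, e 5)]
  -- e₁e₂ = e₃, e₁e₃ = e₄, e₁e₄ = e₅, e₂e₄ = e₆
  | .T03 => [(0, 1, e 2), (0, 2, e 3), (0, 3, e 4), (1, 3, e 5)]
  -- e₁e₂ = e₃, e₁e₃ = e₄, e₁e₅ = e₆, e₂e₄ = e₆
  | .T04 => [(0, 1, e 2), (0, 2, e 3), (0, 4, e 5), (1, 3, e 5)]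
  -- e₁e₂ = e₃, e₁e₃ = e₄, e₂e₃ = e₆, e₄e₅ = e₆
  | .T05 => [(0, 1, e 2), (0, 2, e 3), (1, 2, e 5), (3, 4, e 5)]
  -- e₁e₂ = e₃, e₁e₃ = e₄, e₂e₄ = e₆, e₃e₅ = e₆
  | .T06 => [(0, 1, e 2), (0, 2, e 3), (1, 3, e 5), (2, 4, e 5)]
  -- e₁e₂ = e₃, e₁e₃ = e₄, e₄e₅ = e₆
  | .T07 => [(0, 1, e 2), (0, 2, e 3), (3, 4, e 5)]
  -- e₁e₂ = e₃, e₁e₃ = e₄, e₁e₄ = e₆, e₁e₅ = -e₆, e₂e₃ = e₅, e₂e₄ = e₆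
  | .T08 => [(0, 1, e 2), (0, 2, e 3), (0, 3, e 5), (0, 4, -e 5), (1, 2, e 4), (1, 3, e 5)]
  -- e₁e₂ = e₃, e₁e₃ = e₄, e₁e₅ = (α + 1)e₆, e₂e₃ = e₅, e₂e₄ = αe₆
  | .T09 α => [(0, 1, e 2), (0, 2, e 3), (0, 4, (α + 1) • e 5), (1, 2, e 4), (1, 3, α • e 5)]
  -- e₁e₂ = e₃, e₁e₃ = e₆, e₁e₄ = e₅, e₂e₃ = e₅, e₄e₅ = e₆
  | .T10 => [(0, 1, e 2), (0, 2, e 5), (0, 3, e 4), (1, 2, e 4), (3, 4, e 5)]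
  -- e₁e₂ = e₃, e₁e₄ = e₅, e₁e₅ = e₆, e₂e₃ = e₅
  | .T11 => [(0, 1, e 2), (0, 3, e 4), (0, 4, e 5), (1, 2, e 4)]
  -- e₁e₂ = e₃, e₁e₄ = e₅, e₁e₅ = e₆, e₂e₃ = e₅, e₂e₄ = e₆
  | .T12 => [(0, 1, e 2), (0, 3, e 4), (0, 4, e 5), (1, 2, e 4), (1, 3, e 5)]
  -- e₁e₂ = e₃, e₁e₄ = e₅, e₁e₅ = e₆, e₂e₃ = e₅, e₃e₄ = e₆
  | .T13 => [(0, 1, e 2), (0, 3, e 4), (0, 4, e 5), (1, 2, e 4), (2, 3, e 5)]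
  -- e₁e₂ = e₃, e₁e₄ = e₅, e₂e₃ = e₅, e₄e₅ = e₆
  | .T14 => [(0, 1, e 2), (0, 3, e 4), (1, 2, e 4), (3, 4, e 5)]
  -- e₁e₂ = e₃, e₁e₃ = e₄, e₁e₄ = e₅, e₁e₅ = e₆, e₂e₄ = e₆
  | .T15 => [(0, 1, e 2), (0, 2, e 3), (0, 3, e 4), (0, 4, e 5), (1, 3, e 5)]
  -- e₁e₂ = e₃, e₁e₃ = e₄, e₁e₄ = e₅, e₂e₅ = e₆
  | .T16 => [(0, 1, e 2), (0, 2, e 3), (0, 3, e 4), (1, 4, e 5)]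
  -- e₁e₂ = e₃, e₁e₃ = e₄, e₁e₄ = e₅, e₂e₃ = e₅, e₂e₅ = e₆
  | .T17 => [(0, 1, e 2), (0, 2, e 3), (0, 3, e 4), (1, 2, e 4), (1, 4, e 5)]
  -- e₁e₂ = e₃, e₁e₃ = e₄, e₁e₄ = e₅, e₁e₅ = (α + 1)e₆, e₂e₃ = e₅, e₂e₄ = αe₆
  | .T18 α => [(0, 1, e 2), (0, 2, e 3), (0, 3, e 4), (0, 4, (α + 1) • e 5), (1, 2, e 4),
      (1, 3, α • e 5)]
  -- e₁e₂ = e₃, e₁e₃ = e₄, e₁e₅ = e₆, e₂e₄ = e₅, e₃e₄ = e₆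
  | .T19 => [(0, 1, e 2), (0, 2, e 3), (0, 4, e 5), (1, 3, e 4), (2, 3, e 5)]

/-- The product on `ℂ⁶` given by the multiplication table: anticommutative, and the products of basis
vectors that are neither listed nor opposite to a listed one are zero. -/
def Name.product (N : Name) : Product (Fin 6 → ℂ) :=
  (N.table.map fun t => elementary t.1 t.2.1 t.2.2).sum

/-- The parameter values for which the algebra is a genuinely new one: at the excluded values the
basis vector `e₄` or `e₅` falls into the annihilator, and the algebra is isomorphic to
`T02` (for `T09`) or to `T01` (for `T18`). -/
def Name.Nondegenerate : Name → Prop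
  | .T09 α => α ≠ 0 ∧ α ≠ -1
  | .T18 α => α ≠ -1
  | _ => True

end Tortkara

/-!
Filter a nilpotent algebra by its lower central series `γ₀ ⊇ γ₁ ⊇ γ₂ ⊇ …`, where `γ₀` is the whole
algebra. The symmetries of the linearized Tortkara identity force `γ₁γ₁ ⊆ γ₃` and `γ₁γ₂ ⊆ γ₄`, and
the Malcev identity holds as soon as `γ₃ = 0`. A non-Malcev algebra of dimension six thus has two
or three generators, and in each case the dimensions of the quotients `γₙ / γₙ₊₁` leave a
multiplication table with few free parameters, on which the Tortkara identity imposes a few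
equations. Explicit base changes reduce these tables to the list.

For the non-isomorphism, call colon of two subspaces the subspace of the vectors that multiply the
first into the second. The dimensions of colons iterated from the zero subspace and the whole
algebra depend, for the algebras of the list, only on which structure constants vanish, and they
separate the algebras up to two families. In `T08` and `T09 α`, the generators span a complement of
`γ₁` which multiplication by the product of the generators identifies with `γ₂ / γ₃`, so the
product with values in `γ₃` becomes a bilinear form on it, well defined up to congruence and
scaling; whether its symmetric part vanishes and the ratio of its determinant to the square of its
skew part tell these algebras apart. In `T18 α`, the generator `y` with `y(x(x(xy))) = 0` is unique
modulo `γ₁` and scaling, and `α` is read off the ratio of `x(y(xy))` and `y(x(xy))`.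
-/

namespace Tortkara

/-! ### The listed algebras -/

theorem e_eq_vec : e 0 = ![1, 0, 0, 0, 0, 0] ∧ e 1 = ![0, 1, 0, 0, 0, 0] ∧
    e 2 = ![0, 0, 1, 0, 0, 0] ∧ e 3 = ![0, 0, 0, 1, 0, 0] ∧ e 4 = ![0, 0, 0, 0, 1, 0] ∧
    e 5 = ![0, 0, 0, 0, 0, 1] := by
  refine ⟨?_, ?_, ?_, ?_, ?_, ?_⟩ <;> ext k <;> fin_cases k <;> simp [e]

theorem add_vec (a₀ a₁ a₂ a₃ a₄ a₅ b₀ b₁ b₂ b₃ b₄ b₅ : ℂ) :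
    (![a₀, a₁, a₂, a₃, a₄, a₅] + ![b₀, b₁, b₂, b₃, b₄, b₅] : Fin 6 → ℂ) =
      ![a₀ + b₀, a₁ + b₁, a₂ + b₂, a₃ + b₃, a₄ + b₄, a₅ + b₅] := by
  simp

theorem neg_vec (a₀ a₁ a₂ a₃ a₄ a₅ : ℂ) :
    (-![a₀, a₁, a₂, a₃, a₄, a₅] : Fin 6 → ℂ) = ![-a₀, -a₁, -a₂, -a₃, -a₄, -a₅] := by
  simp

theorem sub_vec (a₀ a₁ a₂ a₃ a₄ a₅ b₀ b₁ b₂ b₃ b₄ b₅ : ℂ) :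
    (![a₀, a₁, a₂, a₃, a₄, a₅] - ![b₀, b₁, b₂, b₃, b₄, b₅] : Fin 6 → ℂ) =
      ![a₀ - b₀, a₁ - b₁, a₂ - b₂, a₃ - b₃, a₄ - b₄, a₅ - b₅] := by
  simp

theorem smul_vec (c a₀ a₁ a₂ a₃ a₄ a₅ : ℂ) :
    (c • ![a₀, a₁, a₂, a₃, a₄, a₅] : Fin 6 → ℂ) =
      ![c * a₀, c * a₁, c * a₂, c * a₃, c * a₄, c * a₅] := by
  simp

theorem vec_eq_vec_iff {a₀ a₁ a₂ a₃ a₄ a₅ b₀ b₁ b₂ b₃ b₄ b₅ : ℂ} :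
    (![a₀, a₁, a₂, a₃, a₄, a₅] : Fin 6 → ℂ) = ![b₀, b₁, b₂, b₃, b₄, b₅] ↔
      a₀ = b₀ ∧ a₁ = b₁ ∧ a₂ = b₂ ∧ a₃ = b₃ ∧ a₄ = b₄ ∧ a₅ = b₅ := by
  simp

section Tables

variable (L : List (Fin 6 × Fin 6 × (Fin 6 → ℂ)))

/-- The anticommutative product on `ℂ⁶` with multiplication table `L`, whose entries `(i, j, v)`
stand for `(e i)(e j) = v`. -/
def ofTable : Product (Fin 6 → ℂ) :=
  (L.map fun t => elementary t.1 t.2.1 t.2.2).sum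

theorem Name.product_eq_ofTable (N : Name) : N.product = ofTable N.table :=
  rfl

theorem ofTable_nil (x y : Fin 6 → ℂ) : ofTable [] x y = ![0, 0, 0, 0, 0, 0] := by
  ext k
  fin_cases k <;> rfl

theorem ofTable_cons (i j : Fin 6) (v x y : Fin 6 → ℂ) :
    ofTable ((i, j, v) :: L) x y = (x i * y j - x j * y i) • v + ofTable L x y := by
  rw [ofTable, List.map_cons, List.sum_cons, LinearMap.add_apply, LinearMap.add_apply]
  rfl

theorem isAnticommutative_ofTable : IsAnticommutative (ofTable L) := by
  intro x y
  induction L with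
  | nil => simp [ofTable_nil]
  | cons t L ih =>
    rw [ofTable_cons, ofTable_cons, ih]
    module

variable {L} {w : Fin 6 → ℕ}

theorem ofTable_apply_eq_zero_of_weight
    (hL : ∀ t ∈ L, ∀ k, t.2.2 k ≠ 0 → w t.1 + w t.2.1 ≤ w k) {m n : ℕ} {x y : Fin 6 → ℂ}
    (hx : ∀ k, w k < m → x k = 0) (hy : ∀ k, w k < n → y k = 0) (k : Fin 6) (hk : w k < m + n) :
    ofTable L x y k = 0 := by
  have coord_mul_eq_zero (i j : Fin 6) (hij : w i + w j ≤ w k) : x i * y j = 0 := by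
    rcases lt_or_ge (w i) m with hi | hi
    · rw [hx i hi, zero_mul]
    · rw [hy j (by lia), mul_zero]
  induction L with
  | nil => simp [ofTable]
  | cons t L ih =>
    obtain ⟨i, j, v⟩ := t
    rw [ofTable_cons, Pi.add_apply, ih fun s hs => hL s (List.mem_cons_of_mem _ hs), Pi.smul_apply,
      smul_eq_mul, add_zero]
    by_cases hv : v k = 0
    · rw [hv, mul_zero]
    · have hij : w i + w j ≤ w k := hL (i, j, v) List.mem_cons_self k hv
      rw [coord_mul_eq_zero i j hij, mul_comm (x j), mul_comm (y i), coord_mul_eq_zero j i (by lia),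
        sub_zero, zero_mul]

theorem isNilpotent_ofTable_of_weight (hw : ∀ k, 1 ≤ w k)
    (hL : ∀ t ∈ L, ∀ k, t.2.2 k ≠ 0 → w t.1 + w t.2.1 ≤ w k) : IsNilpotent (ofTable L) := by
  have weight_of_isProductOf {n : ℕ} {v : Fin 6 → ℂ} (hv : IsProductOf (ofTable L) n v) :
      ∀ k, w k < n → v k = 0 := by
    induction hv with
    | single x => exact fun k hk => absurd (hw k) (by lia)
    | mul _ _ ihx ihy => exact ofTable_apply_eq_zero_of_weight hL ihx ihy
  exact ⟨∑ k, w k + 1, by lia, fun v hv => funext fun k => weight_of_isProductOf hv k <|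
    Nat.lt_succ_of_le <| Finset.single_le_sum (fun _ _ => Nat.zero_le _) (Finset.mem_univ k)⟩

end Tables

theorem Name.isTortkara_product (N : Name) : IsTortkara N.product := by
  refine ⟨isAnticommutative_ofTable N.table, fun a b c => ?_⟩
  cases N <;>
    simp only [jacobian, Name.product_eq_ofTable, Name.table, ofTable_cons, ofTable_nil, e_eq_vec,
      smul_vec, add_vec, neg_vec, vec_eq_vec_iff, Matrix.cons_val, mul_zero, mul_one, zero_mul,
      add_zero, zero_add, sub_zero, zero_sub, neg_zero, true_and, and_true] <;>
    grind

/-- The weights are those of the lower central series, except that `e₄` or `e₅` may be a third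
generator. -/
def Name.weight : Name → Fin 6 → ℕ
  | .T05 | .T06 | .T07 => ![1, 1, 2, 3, 1, 4]
  | .T10 | .T11 | .T12 | .T13 | .T14 => ![1, 1, 2, 1, 3, 4]
  | _ => ![1, 1, 2, 3, 4, 5]

theorem Name.isNilpotent_product (N : Name) : IsNilpotent N.product := by
  refine isNilpotent_ofTable_of_weight (w := N.weight) ?_ ?_
  · cases N <;> simp [Name.weight, Fin.forall_fin_succ]
  · cases N <;> simp [Name.table, Name.weight, Fin.forall_fin_succ, e]

/-- A triple `(x, y, z)` of basis vectors, by index, with `J(x, y, xz) ≠ J(x, y, z)x`. -/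
def Name.nonMalcevTriple : Name → Fin 6 × Fin 6 × Fin 6
  | .T05 | .T07 => (0, 4, 1)
  | .T10 | .T14 => (1, 3, 0)
  | .T16 | .T17 => (0, 1, 2)
  | _ => (0, 1, 1)

theorem Name.not_isMalcev_product (N : Name) : ¬ IsMalcev N.product := by
  rintro ⟨-, h⟩
  have h := h (e N.nonMalcevTriple.1) (e N.nonMalcevTriple.2.1) (e N.nonMalcevTriple.2.2)
  revert h
  cases N <;>
    simp only [Name.nonMalcevTriple, jacobian, Name.product_eq_ofTable, Name.table, ofTable_cons,
      ofTable_nil, e_eq_vec, smul_vec, add_vec, neg_vec, vec_eq_vec_iff, Matrix.cons_val] <;>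
    grind

/-! ### Isomorphisms and bases -/

section Isomorphism

variable {V W X : Type*} [AddCommGroup V] [Module ℂ V] [AddCommGroup W] [Module ℂ W]
  [AddCommGroup X] [Module ℂ X] {μ : Product V} {ν : Product W} {ξ : Product X}

theorem Isomorphic.refl (μ : Product V) : Isomorphic μ μ :=
  ⟨LinearEquiv.refl ℂ V, fun _ _ => rfl⟩

theorem Isomorphic.symm (h : Isomorphic μ ν) : Isomorphic ν μ := by
  obtain ⟨φ, hφ⟩ := h
  exact ⟨φ.symm, fun x y => φ.injective (by simp [hφ])⟩

theorem Isomorphic.trans (h : Isomorphic μ ν) (h' : Isomorphic ν ξ) : Isomorphic μ ξ := by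
  obtain ⟨φ, hφ⟩ := h
  obtain ⟨ψ, hψ⟩ := h'
  exact ⟨φ.trans ψ, fun x y => by simp [hφ, hψ]⟩

theorem map_jacobian {φ : V →ₗ[ℂ] W} (hφ : ∀ x y, φ (μ x y) = ν (φ x) (φ y)) (a b c : V) :
    φ (jacobian μ a b c) = jacobian ν (φ a) (φ b) (φ c) := by
  simp only [jacobian, map_add, hφ]

theorem Isomorphic.isMalcev (h : Isomorphic μ ν) (hν : IsMalcev ν) : IsMalcev μ := by
  obtain ⟨φ, hφ⟩ := h
  have map_jacobian := map_jacobian (φ := φ.toLinearMap) hφ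
  simp only [LinearEquiv.coe_coe] at map_jacobian
  refine ⟨fun x y => φ.injective ?_, fun x y z => φ.injective ?_⟩
  · rw [map_neg, hφ, hφ, hν.1]
  · rw [map_jacobian, hφ, hφ, map_jacobian, hν.2]

theorem IsAnticommutative.mul_self (h : IsAnticommutative μ) (x : V) : μ x x = 0 := by
  have two_smul_eq_zero : (2 : ℂ) • μ x x = 0 := by
    rw [two_smul, ← eq_neg_iff_add_eq_zero, ← h]
  simpa using two_smul_eq_zero

end Isomorphism

section Frames

variable {ι V : Type*} [Fintype ι] [AddCommGroup V] [Module ℂ V] {μ : Product V}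
  {ν : Product (ι → ℂ)} {f : ι → V}

theorem isomorphic_of_basis (b : Module.Basis ι ℂ V)
    (h : ∀ x y : ι → ℂ, μ (∑ i, x i • b i) (∑ i, y i • b i) = ∑ k, ν x y k • b k) :
    Isomorphic μ ν :=
  Isomorphic.symm ⟨b.equivFun.symm, fun x y => by simp only [Module.Basis.equivFun_symm_apply, h]⟩

theorem isomorphic_of_linearIndependent [FiniteDimensional ℂ V] (hf : LinearIndependent ℂ f)
    (hV : Module.finrank ℂ V = Fintype.card ι)
    (h : ∀ x y : ι → ℂ, μ (∑ i, x i • f i) (∑ i, y i • f i) = ∑ k, ν x y k • f k) :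
    Isomorphic μ ν :=
  isomorphic_of_basis (basisOfLinearIndependentOfCardEqFinrank' f hf hV.symm) (by simpa using h)

theorem isomorphic_of_span_eq_top [LinearOrder ι] (hμ : IsAnticommutative μ)
    (hν : IsAnticommutative ν) (hf : Submodule.span ℂ (Set.range f) = ⊤)
    (hV : Module.finrank ℂ V = Fintype.card ι)
    (h : ∀ i j, i < j → μ (f i) (f j) = Fintype.linearCombination ℂ f
      (ν (Pi.single i 1) (Pi.single j 1))) :
    Isomorphic μ ν := by
  let φ := Fintype.linearCombination ℂ f
  have mul_apply (i j : ι) : μ (f i) (f j) = φ (ν (Pi.single i 1) (Pi.single j 1)) := by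
    rcases lt_trichotomy i j with hij | rfl | hij
    · exact h i j hij
    · rw [hμ.mul_self, hν.mul_self, map_zero]
    · rw [hμ, hν, map_neg, h j i hij]
  have mul_linearCombination : μ.compl₁₂ φ φ = ν.compr₂ φ :=
    LinearMap.ext_basis (Pi.basisFun ℂ ι) (Pi.basisFun ℂ ι) fun i j => by
      simpa [φ, Fintype.linearCombination_apply_single] using mul_apply i j
  exact isomorphic_of_basis (basisOfTopLeSpanOfCardEqFinrank f hf.ge hV.symm) fun x y => by
    simpa [φ, Fintype.linearCombination_apply] using LinearMap.congr_fun₂ mul_linearCombination x y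

end Frames

/-! ### Normal forms -/

theorem isomorphic_of_rows {μ ν : Product (Fin 6 → ℂ)} (f : Fin 6 → Fin 6 → ℂ)
    (hf : ∀ x : Fin 6 → ℂ, ∑ i, x i • f i = ![0, 0, 0, 0, 0, 0] →
      x 0 = 0 ∧ x 1 = 0 ∧ x 2 = 0 ∧ x 3 = 0 ∧ x 4 = 0 ∧ x 5 = 0)
    (h : ∀ x y : Fin 6 → ℂ, μ (∑ i, x i • f i) (∑ i, y i • f i) = ∑ k, ν x y k • f k) :
    Isomorphic μ ν := by
  refine isomorphic_of_linearIndependent (Fintype.linearIndependent_iff.mpr fun x hx => ?_)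
    (by simp) h
  have zero_eq_vec : (0 : Fin 6 → ℂ) = ![0, 0, 0, 0, 0, 0] := by ext k; fin_cases k <;> rfl
  simpa [Fin.forall_fin_succ] using hf x (hx.trans zero_eq_vec)

/-- The algebras with three generators `x = e 0`, `y = e 1`, `t = e 4`, where `xy = z = e 2`,
`xz = w = e 3` and `u = e 5` spans the last nonzero term of the lower central series. -/
def threeGen (p q a b c d k l m : ℂ) : Product (Fin 6 → ℂ) := ofTable
  [(0, 1, e 2), (0, 4, a • e 3 + b • e 5), (0, 2, e 3), (0, 3, k • e 5),
    (1, 4, c • e 3 + d • e 5), (1, 2, p • e 5), (1, 3, l • e 5), (4, 2, q • e 5), (4, 3, m • e 5)]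

theorem isomorphic_threeGen_smul (p q a b c d k l m : ℂ) {r : ℂ} (hr : r ≠ 0) :
    Isomorphic (threeGen p q a b c d k l m)
      (threeGen (p / r) (q / r) a (b / r) c (d / r) (k / r) (l / r) (m / r)) := by
  refine isomorphic_of_rows ![e 0, e 1, e 2, e 3, e 4, r • e 5] (fun x hx => ?_) fun x y => ?_ <;>
    simp only [threeGen, ofTable_cons, ofTable_nil, Fin.sum_univ_six, Matrix.cons_val, e_eq_vec,
      smul_vec, add_vec, vec_eq_vec_iff] at * <;>
    grind

theorem isomorphic_threeGen_of_tw (p q a b c d k l : ℂ) :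
    Isomorphic (threeGen p q a b c d k l 1)
      (threeGen (p - l * q) (q + (k * c - l * a)) a (b + a * k * q) c (d + c * k * q) 0 0 1) := by
  refine isomorphic_of_rows ![e 0 - k • e 4, e 1 - l • e 4,
    e 2 + (k * c - l * a) • e 3 + (k * d - l * b) • e 5, e 3 - (k * q) • e 5, e 4, e 5]
    (fun x hx => ?_) fun x y => ?_ <;>
    simp only [threeGen, ofTable_cons, ofTable_nil, Fin.sum_univ_six, Matrix.cons_val, e_eq_vec,
      smul_vec, add_vec, sub_vec, vec_eq_vec_iff] at * <;>
    grind

theorem isomorphic_threeGen_of_tw_reduced (p q a b c d : ℂ) :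
    Isomorphic (threeGen p q a b c d 0 0 1) (threeGen p 0 0 0 c 0 0 0 1) := by
  refine isomorphic_of_rows ![e 0 + b • e 3, e 1 - q • e 2 + (d + q ^ 2 - a * p) • e 3,
    e 2 - q • e 3, e 3, e 4 - a • e 2 + (a * q) • e 3, e 5] (fun x hx => ?_) fun x y => ?_ <;>
    simp only [threeGen, ofTable_cons, ofTable_nil, Fin.sum_univ_six, Matrix.cons_val, e_eq_vec,
      smul_vec, add_vec, sub_vec, vec_eq_vec_iff] at * <;>
    grind

theorem isomorphic_threeGen_of_yw (p q a b c d k : ℂ) :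
    Isomorphic (threeGen p q a b c d k 1 0)
      (threeGen p q (a - k * c) (b - k * d + (a - k * c) * k * p) c (d + c * k * p) 0 1 0) := by
  refine isomorphic_of_rows ![e 0 - k • e 1, e 1, e 2, e 3 - (k * p) • e 5, e 4, e 5]
    (fun x hx => ?_) fun x y => ?_ <;>
    simp only [threeGen, ofTable_cons, ofTable_nil, Fin.sum_univ_six, Matrix.cons_val, e_eq_vec,
      smul_vec, add_vec, sub_vec, vec_eq_vec_iff] at * <;>
    grind

theorem isomorphic_threeGen_of_yw_reduced (p q a b c d : ℂ) :
    Isomorphic (threeGen p q a b c d 0 1 0) (threeGen 0 q 0 b c 0 0 1 0) := by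
  refine isomorphic_of_rows ![e 0, e 1 - p • e 2, e 2 - p • e 3, e 3,
    e 4 - a • e 2 + (a * p - (d + p * q)) • e 3, e 5] (fun x hx => ?_) fun x y => ?_ <;>
    simp only [threeGen, ofTable_cons, ofTable_nil, Fin.sum_univ_six, Matrix.cons_val, e_eq_vec,
      smul_vec, add_vec, sub_vec, vec_eq_vec_iff] at * <;>
    grind

theorem isomorphic_threeGen_of_tz_ne_zero {q : ℂ} (b c : ℂ) (hq : q ≠ 0) :
    Isomorphic (threeGen 0 q 0 b c 0 0 1 0) (threeGen 0 q 0 0 c 0 0 1 0) := by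
  refine isomorphic_of_rows ![e 0 + (b / q) • e 2, e 1, e 2, e 3, e 4, e 5]
    (fun x hx => ?_) fun x y => ?_ <;>
    simp only [threeGen, ofTable_cons, ofTable_nil, Fin.sum_univ_six, Matrix.cons_val, e_eq_vec,
      smul_vec, add_vec, vec_eq_vec_iff] at * <;>
    grind

theorem isomorphic_threeGen_T00 :
    Isomorphic (threeGen 0 0 0 0 0 0 0 1 0) Name.T00.product := by
  refine isomorphic_of_rows ![e 0, e 1, e 2, e 3, e 5, e 4] (fun x hx => ?_) fun x y => ?_ <;>
    simp only [threeGen, Name.product_eq_ofTable, Name.table, ofTable_cons, ofTable_nil,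
      Fin.sum_univ_six, Matrix.cons_val, e_eq_vec, smul_vec, add_vec, vec_eq_vec_iff] at * <;>
    grind

theorem isomorphic_threeGen_T04 {b : ℂ} (hb : b ≠ 0) :
    Isomorphic (threeGen 0 0 0 b 0 0 0 1 0) Name.T04.product := by
  refine isomorphic_of_rows ![e 0, e 1, e 2, e 3, (1 / b) • e 4, e 5]
    (fun x hx => ?_) fun x y => ?_ <;>
    simp only [threeGen, Name.product_eq_ofTable, Name.table, ofTable_cons, ofTable_nil,
      Fin.sum_univ_six, Matrix.cons_val, e_eq_vec, smul_vec, add_vec, vec_eq_vec_iff] at * <;>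
    grind

theorem isomorphic_threeGen_T05 {p : ℂ} (hp : p ≠ 0) :
    Isomorphic (threeGen p 0 0 0 0 0 0 0 1) Name.T05.product := by
  refine isomorphic_of_rows ![e 0, e 1, e 2, e 3, (-p) • e 4, p • e 5]
    (fun x hx => ?_) fun x y => ?_ <;>
    simp only [threeGen, Name.product_eq_ofTable, Name.table, ofTable_cons, ofTable_nil,
      Fin.sum_univ_six, Matrix.cons_val, e_eq_vec, smul_vec, add_vec, vec_eq_vec_iff] at * <;>
    grind

theorem isomorphic_threeGen_T06 {q : ℂ} (hq : q ≠ 0) :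
    Isomorphic (threeGen 0 q 0 0 0 0 0 1 0) Name.T06.product := by
  refine isomorphic_of_rows ![e 0, e 1, e 2, e 3, (-1 / q) • e 4, e 5]
    (fun x hx => ?_) fun x y => ?_ <;>
    simp only [threeGen, Name.product_eq_ofTable, Name.table, ofTable_cons, ofTable_nil,
      Fin.sum_univ_six, Matrix.cons_val, e_eq_vec, smul_vec, add_vec, vec_eq_vec_iff] at * <;>
    grind

theorem isomorphic_threeGen_T07 :
    Isomorphic (threeGen 0 0 0 0 0 0 0 0 1) Name.T07.product := by
  refine isomorphic_of_rows ![e 0, e 1, e 2, e 3, -e 4, e 5] (fun x hx => ?_) fun x y => ?_ <;>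
    simp only [threeGen, Name.product_eq_ofTable, Name.table, ofTable_cons, ofTable_nil,
      Fin.sum_univ_six, Matrix.cons_val, e_eq_vec, smul_vec, add_vec, neg_vec, vec_eq_vec_iff] at *
      <;>
    grind

theorem isomorphic_threeGen_T10 {p c : ℂ} (hp : p ≠ 0) (hc : c ≠ 0) :
    Isomorphic (threeGen p 0 0 0 c 0 0 0 1) Name.T10.product := by
  refine isomorphic_of_rows ![(-1 / (p * c)) • e 1, e 0, (1 / (p * c)) • e 2, (-1 / c) • e 4,
    (1 / (p * c)) • e 3, (-1 / (p * c ^ 2)) • e 5] (fun x hx => ?_) fun x y => ?_ <;>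
    simp only [threeGen, Name.product_eq_ofTable, Name.table, ofTable_cons, ofTable_nil,
      Fin.sum_univ_six, Matrix.cons_val, e_eq_vec, smul_vec, add_vec, vec_eq_vec_iff] at * <;>
    grind

theorem isomorphic_threeGen_T11 {c : ℂ} (hc : c ≠ 0) :
    Isomorphic (threeGen 0 0 0 0 c 0 0 1 0) Name.T11.product := by
  refine isomorphic_of_rows ![-e 1, e 0, e 2, (-1 / c) • e 4, e 3, -e 5]
    (fun x hx => ?_) fun x y => ?_ <;>
    simp only [threeGen, Name.product_eq_ofTable, Name.table, ofTable_cons, ofTable_nil,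
      Fin.sum_univ_six, Matrix.cons_val, e_eq_vec, smul_vec, add_vec, neg_vec, vec_eq_vec_iff] at *
      <;>
    grind

theorem isomorphic_threeGen_T12 {b c : ℂ} (hb : b ≠ 0) (hc : c ≠ 0) :
    Isomorphic (threeGen 0 0 0 b c 0 0 1 0) Name.T12.product := by
  refine isomorphic_of_rows ![-e 1, (c / b) • e 0, (c / b) • e 2, (-c / b ^ 2) • e 4,
    (c / b) ^ 2 • e 3, (-(c / b) ^ 2) • e 5] (fun x hx => ?_) fun x y => ?_ <;>
    simp only [threeGen, Name.product_eq_ofTable, Name.table, ofTable_cons, ofTable_nil,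
      Fin.sum_univ_six, Matrix.cons_val, e_eq_vec, smul_vec, add_vec, neg_vec, vec_eq_vec_iff] at *
      <;>
    grind

theorem isomorphic_threeGen_T13 {q c : ℂ} (hq : q ≠ 0) (hc : c ≠ 0) :
    Isomorphic (threeGen 0 q 0 0 c 0 0 1 0) Name.T13.product := by
  refine isomorphic_of_rows ![(q / c) • e 1, e 0, (-q / c) • e 2, (-1 / c) • e 4, (-q / c) • e 3,
    (-(q / c) ^ 2) • e 5] (fun x hx => ?_) fun x y => ?_ <;>
    simp only [threeGen, Name.product_eq_ofTable, Name.table, ofTable_cons, ofTable_nil,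
      Fin.sum_univ_six, Matrix.cons_val, e_eq_vec, smul_vec, add_vec, vec_eq_vec_iff] at * <;>
    grind

theorem isomorphic_threeGen_T14 {c : ℂ} (hc : c ≠ 0) :
    Isomorphic (threeGen 0 0 0 0 c 0 0 0 1) Name.T14.product := by
  refine isomorphic_of_rows ![-e 1, e 0, e 2, (-1 / c) • e 4, e 3, (-1 / c) • e 5]
    (fun x hx => ?_) fun x y => ?_ <;>
    simp only [threeGen, Name.product_eq_ofTable, Name.table, ofTable_cons, ofTable_nil,
      Fin.sum_univ_six, Matrix.cons_val, e_eq_vec, smul_vec, add_vec, neg_vec, vec_eq_vec_iff] at *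
      <;>
    grind

section IsListed

variable {V W : Type*} [AddCommGroup V] [Module ℂ V] [AddCommGroup W] [Module ℂ W]
  {μ : Product V} {ν : Product W}

/-- The conclusion of the classification: the algebra is isomorphic to one of the list. -/
def IsListed (μ : Product V) : Prop :=
  ∃ N : Name, N.Nondegenerate ∧ Isomorphic μ N.product

theorem Isomorphic.isListed (h : Isomorphic μ ν) (hν : IsListed ν) : IsListed μ := by
  obtain ⟨N, hN, hνN⟩ := hν
  exact ⟨N, hN, h.trans hνN⟩

end IsListed

section ThreeGenerators

variable (p q a b c d k l m : ℂ)

theorem isMalcev_threeGen : IsMalcev (threeGen p q a b c d k 0 0) := by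
  refine ⟨isAnticommutative_ofTable _, fun x y z => ?_⟩
  simp only [jacobian, threeGen, ofTable_cons, ofTable_nil, Matrix.cons_val, e_eq_vec, smul_vec,
    add_vec, vec_eq_vec_iff]
  grind

theorem isListed_threeGen_of_tw : IsListed (threeGen p q a b c d k l 1) := by
  suffices ∀ p c, IsListed (threeGen p 0 0 0 c 0 0 0 1) from
    ((isomorphic_threeGen_of_tw ..).trans (isomorphic_threeGen_of_tw_reduced ..)).isListed
      (this _ _)
  intro p c
  rcases eq_or_ne p 0 with rfl | hp <;> rcases eq_or_ne c 0 with rfl | hc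
  · exact ⟨.T07, trivial, isomorphic_threeGen_T07⟩
  · exact ⟨.T14, trivial, isomorphic_threeGen_T14 hc⟩
  · exact ⟨.T05, trivial, isomorphic_threeGen_T05 hp⟩
  · exact ⟨.T10, trivial, isomorphic_threeGen_T10 hp hc⟩

theorem isListed_threeGen_of_yw : IsListed (threeGen p q a b c d k 1 0) := by
  suffices ∀ q b c, IsListed (threeGen 0 q 0 b c 0 0 1 0) from
    ((isomorphic_threeGen_of_yw ..).trans (isomorphic_threeGen_of_yw_reduced ..)).isListed
      (this _ _ _)
  intro q b c
  rcases eq_or_ne q 0 with rfl | hq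
  · rcases eq_or_ne b 0 with rfl | hb <;> rcases eq_or_ne c 0 with rfl | hc
    · exact ⟨.T00, trivial, isomorphic_threeGen_T00⟩
    · exact ⟨.T11, trivial, isomorphic_threeGen_T11 hc⟩
    · exact ⟨.T04, trivial, isomorphic_threeGen_T04 hb⟩
    · exact ⟨.T12, trivial, isomorphic_threeGen_T12 hb hc⟩
  · refine (isomorphic_threeGen_of_tz_ne_zero b c hq).isListed ?_
    rcases eq_or_ne c 0 with rfl | hc
    · exact ⟨.T06, trivial, isomorphic_threeGen_T06 hq⟩
    · exact ⟨.T13, trivial, isomorphic_threeGen_T13 hq hc⟩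

theorem isListed_threeGen (h : ¬ IsMalcev (threeGen p q a b c d k l m)) :
    IsListed (threeGen p q a b c d k l m) := by
  rcases eq_or_ne m 0 with rfl | hm
  · have hl : l ≠ 0 := by
      rintro rfl
      exact h (isMalcev_threeGen ..)
    have scale := isomorphic_threeGen_smul p q a b c d k l 0 hl
    rw [div_self hl, zero_div] at scale
    exact scale.isListed (isListed_threeGen_of_yw ..)
  · have scale := isomorphic_threeGen_smul p q a b c d k l m hm
    rw [div_self hm] at scale
    exact scale.isListed (isListed_threeGen_of_tw ..)

end ThreeGenerators

/-- The algebras with generators `a = e 0` and `b = e 1` in which `c = ab`, the products `ac = e 3`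
and `bc = e 4` are independent, and multiplication by `a` and `b` sends these to the multiples of
`e 5` given by the bilinear form `M`. -/
def form (M : Matrix (Fin 2) (Fin 2) ℂ) : Product (Fin 6 → ℂ) := ofTable
  [(0, 1, e 2), (0, 2, e 3), (0, 3, M 0 0 • e 5), (0, 4, M 0 1 • e 5), (1, 2, e 4),
    (1, 3, M 1 0 • e 5), (1, 4, M 1 1 • e 5)]

theorem Name.product_T02 : Name.T02.product = form !![0, 0; 1, 0] := by
  refine LinearMap.ext₂ fun x y => ?_
  simp [Name.product_eq_ofTable, Name.table, form, ofTable_cons]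

theorem Name.product_T08 : Name.T08.product = form !![1, -1; 1, 0] := by
  refine LinearMap.ext₂ fun x y => ?_
  simp [Name.product_eq_ofTable, Name.table, form, ofTable_cons]

theorem Name.product_T09 (α : ℂ) : (Name.T09 α).product = form !![0, α + 1; α, 0] := by
  refine LinearMap.ext₂ fun x y => ?_
  simp [Name.product_eq_ofTable, Name.table, form, ofTable_cons]

theorem isomorphic_form {M M' P : Matrix (Fin 2) (Fin 2) ℂ} {r : ℂ} (hr : r ≠ 0) (hP : P.det ≠ 0)
    (h : r • M' = P.det • (P * M * P.transpose)) : Isomorphic (form M) (form M') := by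
  refine isomorphic_of_rows ![P 0 0 • e 0 + P 0 1 • e 1, P 1 0 • e 0 + P 1 1 • e 1, P.det • e 2,
    P.det • (P 0 0 • e 3 + P 0 1 • e 4), P.det • (P 1 0 • e 3 + P 1 1 • e 4), r • e 5]
    (fun x hx => ?_) fun x y => ?_
  · have eq_zero_of_combination {s t : ℂ} (h₀ : s * P 0 0 + t * P 1 0 = 0)
        (h₁ : s * P 0 1 + t * P 1 1 = 0) : s = 0 ∧ t = 0 := by
      rw [Matrix.det_fin_two] at hP
      exact ⟨mul_right_cancel₀ hP (by linear_combination P 1 1 * h₀ - P 1 0 * h₁),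
        mul_right_cancel₀ hP (by linear_combination P 0 0 * h₁ - P 0 1 * h₀)⟩
    simp only [Fin.sum_univ_six, Matrix.cons_val, e_eq_vec, smul_vec, add_vec, vec_eq_vec_iff,
      mul_zero, mul_one, add_zero, zero_add] at hx
    obtain ⟨hx₀, hx₁, hx₂, hx₃, hx₄, hx₅⟩ := hx
    obtain ⟨h₀, h₁⟩ := eq_zero_of_combination hx₀ hx₁
    obtain ⟨h₃, h₄⟩ := eq_zero_of_combination (s := x 3) (t := x 4)
      (mul_right_cancel₀ hP (by linear_combination hx₃))
      (mul_right_cancel₀ hP (by linear_combination hx₄))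
    exact ⟨h₀, h₁, by simpa [hP] using hx₂, h₃, h₄, by simpa [hr] using hx₅⟩
  · simp only [← Matrix.ext_iff, Fin.forall_fin_two, Matrix.smul_apply, Matrix.mul_apply,
      Fin.sum_univ_two, Matrix.transpose_apply, smul_eq_mul] at h
    simp only [form, ofTable_cons, ofTable_nil, Fin.sum_univ_six, Matrix.cons_val, e_eq_vec,
      smul_vec, add_vec, vec_eq_vec_iff]
    refine ⟨by ring, by ring, by rw [Matrix.det_fin_two]; ring, by rw [Matrix.det_fin_two]; ring,
      by rw [Matrix.det_fin_two]; ring, ?_⟩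
    linear_combination (x 3 * y 0 - x 0 * y 3) * h.1.1 + (x 4 * y 0 - x 0 * y 4) * h.1.2 +
      (x 3 * y 1 - x 1 * y 3) * h.2.1 + (x 4 * y 1 - x 1 * y 4) * h.2.2

theorem isMalcev_form {M : Matrix (Fin 2) (Fin 2) ℂ} (hM : M.IsSymm) : IsMalcev (form M) := by
  refine ⟨isAnticommutative_ofTable _, fun x y z => ?_⟩
  simp only [jacobian, form, ofTable_cons, ofTable_nil, Matrix.cons_val, e_eq_vec, smul_vec,
    add_vec, vec_eq_vec_iff, hM.apply 0 1]
  grind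

section Forms

variable {a b c : ℂ}

theorem transpose_fin_two_of (a b c d : ℂ) : !![a, b; c, d].transpose = !![a, c; b, d] :=
  (Matrix.transposeᵣ_eq _).symm

theorem isomorphic_T09_swap (α : ℂ) :
    Isomorphic (Name.T09 α).product (Name.T09 (-α - 1)).product := by
  rw [Name.product_T09, Name.product_T09]
  refine isomorphic_form (P := !![0, 1; 1, 0]) one_ne_zero (by simp) ?_
  simp [transpose_fin_two_of]
  ring

theorem isomorphic_T09_zero_T02 : Isomorphic (Name.T09 0).product Name.T02.product := by
  rw [Name.product_T09, Name.product_T02]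
  exact isomorphic_form (P := !![0, 1; 1, 0]) (r := -1) (by simp) (by simp)
    (by simp [transpose_fin_two_of])

theorem isomorphic_T09_neg_one_T02 : Isomorphic (Name.T09 (-1)).product Name.T02.product := by
  have h := isomorphic_T09_swap (-1)
  rw [neg_neg, sub_self] at h
  exact h.trans isomorphic_T09_zero_T02

theorem isomorphic_form_T08 (ha : a ≠ 0) (hc : c ≠ 0) :
    Isomorphic (form !![a, -c; c, 0]) Name.T08.product := by
  rw [Name.product_T08]
  refine isomorphic_form (P := !![1, 0; 0, a / c]) (r := a ^ 2 / c) (by simp [*]) (by simp [*]) ?_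
  simp [transpose_fin_two_of]
  field_simp
  simp

theorem isomorphic_form_T09 (hbc : b ≠ c) :
    Isomorphic (form !![0, b; c, 0]) (Name.T09 (c / (b - c))).product := by
  have hbc' : b - c ≠ 0 := sub_ne_zero.mpr hbc
  rw [Name.product_T09]
  refine isomorphic_form (P := 1) hbc' (by simp) ?_
  simp [hbc', mul_add, mul_div_cancel₀]

theorem isomorphic_form_of_add_ne_zero (h : b + c ≠ 0) :
    Isomorphic (form !![a, b; c, 0]) (form !![0, b; c, 0]) := by
  refine isomorphic_form (P := !![1, -a / (b + c); 0, 1]) one_ne_zero (by simp) ?_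
  simp [transpose_fin_two_of]
  field_simp
  ring

theorem isomorphic_form_of_root {d s : ℂ} (hs : d * (s * s) + (b + c) * s + a = 0) :
    Isomorphic (form !![a, b; c, d]) (form !![d, c + d * s; b + d * s, 0]) := by
  refine isomorphic_form (P := !![0, 1; 1, s]) (r := -1) (by simp) (by simp) ?_
  simp [transpose_fin_two_of]
  grind

end Forms

theorem isListed_form_isotropic {b c : ℂ} (hbc : b ≠ c) : IsListed (form !![0, b; c, 0]) := by
  have h := isomorphic_form_T09 hbc
  by_cases hα : (Name.T09 (c / (b - c))).Nondegenerate
  · exact ⟨_, hα, h⟩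
  · rw [Name.Nondegenerate, not_and_or, not_not, not_not] at hα
    rcases hα with hα | hα <;> rw [hα] at h
    · exact ⟨.T02, trivial, h.trans isomorphic_T09_zero_T02⟩
    · exact ⟨.T02, trivial, h.trans isomorphic_T09_neg_one_T02⟩

theorem isListed_form_of_apply_one_one_eq_zero {a b c : ℂ} (hbc : b ≠ c) :
    IsListed (form !![a, b; c, 0]) := by
  rcases eq_or_ne (b + c) 0 with h | h
  · obtain rfl := eq_neg_of_add_eq_zero_left h
    rcases eq_or_ne a 0 with rfl | ha
    · exact isListed_form_isotropic hbc
    · exact ⟨.T08, trivial, isomorphic_form_T08 ha fun hc => hbc (by simp [hc])⟩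
  · exact (isomorphic_form_of_add_ne_zero h).isListed (isListed_form_isotropic hbc)

theorem isListed_form {M : Matrix (Fin 2) (Fin 2) ℂ} (h : ¬ IsMalcev (form M)) :
    IsListed (form M) := by
  have hM : M 0 1 ≠ M 1 0 := fun hM => h (isMalcev_form (Matrix.IsSymm.ext fun i j => by
    fin_cases i <;> fin_cases j <;> simp [hM]))
  rw [M.eta_fin_two]
  rcases eq_or_ne (M 1 1) 0 with hd | hd
  · rw [hd]
    exact isListed_form_of_apply_one_one_eq_zero hM
  · obtain ⟨r, hr⟩ := IsAlgClosed.exists_pow_nat_eq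
      (discrim (M 1 1) (M 0 1 + M 1 0) (M 0 0)) two_pos
    obtain ⟨s, hs⟩ := exists_quadratic_eq_zero hd ⟨r, by rw [← hr, sq]⟩
    exact (isomorphic_form_of_root hs).isListed
      (isListed_form_of_apply_one_one_eq_zero (by simpa using hM.symm))

/-- The algebras with generators `e 0` and `e 1` whose successive products `e 2`, `e 3`, `e 4` with
`e 0` and product `e 5 = e 1 * e 3` leave only `e 1 * e 2 = a e 4 + b e 5` free. -/
def plane (a b : ℂ) : Product (Fin 6 → ℂ) := ofTable
  [(0, 1, e 2), (0, 2, e 3), (0, 3, e 4), (1, 2, a • e 4 + b • e 5), (1, 3, e 5)]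

theorem Name.product_T03 : Name.T03.product = plane 0 0 := by
  refine LinearMap.ext₂ fun x y => ?_
  simp [Name.product_eq_ofTable, Name.table, plane, ofTable_cons]

theorem isomorphic_plane (a b : ℂ) :
    Isomorphic (plane a b) (plane a 0) := by
  refine isomorphic_of_rows ![e 0, e 1 - b • e 2, e 2 - b • e 3, e 3 - b • e 4, e 4, e 5]
    (fun x hx => ?_) fun x y => ?_ <;>
    simp only [plane, ofTable_cons, ofTable_nil, Fin.sum_univ_six, Matrix.cons_val, e_eq_vec,
      smul_vec, add_vec, sub_vec, vec_eq_vec_iff] at * <;>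
    grind

theorem isomorphic_plane_T01 {a : ℂ} (ha : a ≠ 0) :
    Isomorphic (plane a 0) Name.T01.product := by
  refine isomorphic_of_rows ![a • e 0, a • e 1, a ^ 2 • e 2, a ^ 3 • e 3, a ^ 4 • e 4, a ^ 4 • e 5]
    (fun x hx => ?_) fun x y => ?_ <;>
    simp only [plane, Name.product_eq_ofTable, Name.table, ofTable_cons, ofTable_nil,
      Fin.sum_univ_six, Matrix.cons_val, e_eq_vec, smul_vec, add_vec, vec_eq_vec_iff] at * <;>
    grind

theorem isListed_plane (a b : ℂ) : IsListed (plane a b) := by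
  refine (isomorphic_plane a b).isListed ?_
  rcases eq_or_ne a 0 with rfl | ha
  · exact ⟨.T03, trivial, Name.product_T03 ▸ Isomorphic.refl _⟩
  · exact ⟨.T01, trivial, isomorphic_plane_T01 ha⟩

/-- The algebras with generators `x = e 0` and `y = e 1` and further basis vectors `xy`, `x(xy)`,
`s = y(x(xy))` and `xs`, in which `ys = 0`. -/
def twisted (a b k l : ℂ) : Product (Fin 6 → ℂ) := ofTable
  [(0, 1, e 2), (0, 2, e 3), (0, 3, k • e 4 + l • e 5), (0, 4, e 5), (1, 2, a • e 4 + b • e 5),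
    (1, 3, e 4), (2, 3, e 5)]

theorem Name.product_T19 : Name.T19.product = twisted 0 0 0 0 := by
  refine LinearMap.ext₂ fun x y => ?_
  simp [Name.product_eq_ofTable, Name.table, twisted, ofTable_cons]

theorem isomorphic_twisted (a b k l : ℂ) :
    Isomorphic (twisted a b k l) (twisted a b 0 (l - k * a)) := by
  refine isomorphic_of_rows ![e 0 - k • e 1, e 1, e 2, e 3 - (k * a) • e 4 - (k * b) • e 5, e 4,
    e 5] (fun x hx => ?_) fun x y => ?_ <;>
    simp only [twisted, ofTable_cons, ofTable_nil, Fin.sum_univ_six, Matrix.cons_val, e_eq_vec,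
      smul_vec, add_vec, sub_vec, vec_eq_vec_iff] at * <;>
    grind

theorem isomorphic_twisted_of_xw (a b l : ℂ) :
    Isomorphic (twisted a b 0 l) (twisted 0 (b + a ^ 2) 0 l) := by
  refine isomorphic_of_rows ![e 0, e 1 - a • e 2, e 2 - a • e 3, e 3 - (a * l) • e 5,
    e 4 - a • e 5, e 5] (fun x hx => ?_) fun x y => ?_ <;>
    simp only [twisted, ofTable_cons, ofTable_nil, Fin.sum_univ_six, Matrix.cons_val, e_eq_vec,
      smul_vec, add_vec, sub_vec, vec_eq_vec_iff] at * <;>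
    grind

theorem isomorphic_twisted_reduced (b l : ℂ) :
    Isomorphic (twisted 0 b 0 l) (twisted 0 0 0 0) := by
  refine isomorphic_of_rows ![e 0 - l • e 2, e 1 + b • e 3, e 2 + (b * l) • e 5, e 3, e 4, e 5]
    (fun x hx => ?_) fun x y => ?_ <;>
    simp only [twisted, ofTable_cons, ofTable_nil, Fin.sum_univ_six, Matrix.cons_val, e_eq_vec,
      smul_vec, add_vec, sub_vec, vec_eq_vec_iff] at * <;>
    grind

theorem isListed_twisted (a b k l : ℂ) : IsListed (twisted a b k l) :=
  ⟨.T19, trivial, Name.product_T19 ▸ (isomorphic_twisted a b k l).trans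
    ((isomorphic_twisted_of_xw a b _).trans (isomorphic_twisted_reduced _ _))⟩

/-- The algebras with generators `e 0` and `e 1` and successive products `e 2`, `e 3`, `e 4` with
`e 0`, in which multiplication by `e 0` and `e 1` sends `e 4` to multiples of `e 5`. -/
def chain (a b l n m : ℂ) : Product (Fin 6 → ℂ) := ofTable
  [(0, 1, e 2), (0, 2, e 3), (0, 3, e 4), (0, 4, n • e 5), (1, 2, a • e 4 + b • e 5),
    (1, 3, l • e 5), (1, 4, m • e 5)]

theorem Name.product_T15 : Name.T15.product = chain 0 0 1 1 0 := by
  refine LinearMap.ext₂ fun x y => ?_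
  simp [Name.product_eq_ofTable, Name.table, chain, ofTable_cons]

theorem Name.product_T16 : Name.T16.product = chain 0 0 0 0 1 := by
  refine LinearMap.ext₂ fun x y => ?_
  simp [Name.product_eq_ofTable, Name.table, chain, ofTable_cons]

theorem Name.product_T17 : Name.T17.product = chain 1 0 0 0 1 := by
  refine LinearMap.ext₂ fun x y => ?_
  simp [Name.product_eq_ofTable, Name.table, chain, ofTable_cons]

theorem Name.product_T18 (α : ℂ) : (Name.T18 α).product = chain 1 0 α (α + 1) 0 := by
  refine LinearMap.ext₂ fun x y => ?_
  simp [Name.product_eq_ofTable, Name.table, chain, ofTable_cons]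

theorem isomorphic_chain_scale (a b l n m : ℂ) {β δ : ℂ} (hβ : β ≠ 0) (hδ : δ ≠ 0) :
    Isomorphic (chain a b l n m)
      (chain (β * a) (β ^ 2 * b / δ) (β ^ 2 * l / δ) (β * n / δ) (β ^ 2 * m / δ)) := by
  refine isomorphic_of_rows ![e 0, β • e 1, β • e 2, β • e 3, β • e 4, δ • e 5]
    (fun x hx => ?_) fun x y => ?_ <;>
    simp only [chain, ofTable_cons, ofTable_nil, Fin.sum_univ_six, Matrix.cons_val, e_eq_vec,
      smul_vec, add_vec, vec_eq_vec_iff] at * <;>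
    grind

theorem isomorphic_chain_of_ys (a b l n : ℂ) :
    Isomorphic (chain a b l n 1) (chain a (b + a * n * l) (l - n * a) 0 1) := by
  refine isomorphic_of_rows ![e 0 - n • e 1, e 1, e 2, e 3 - (n * a) • e 4 - (n * b) • e 5,
    e 4 - (n * l) • e 5, e 5] (fun x hx => ?_) fun x y => ?_ <;>
    simp only [chain, ofTable_cons, ofTable_nil, Fin.sum_univ_six, Matrix.cons_val, e_eq_vec,
      smul_vec, add_vec, sub_vec, vec_eq_vec_iff] at * <;>
    grind

theorem isomorphic_chain_of_ys_reduced (a b l : ℂ) :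
    Isomorphic (chain a b l 0 1) (chain a 0 0 0 1) := by
  refine isomorphic_of_rows ![e 0, e 1 - l • e 2 + (l ^ 2 - b) • e 3,
    e 2 - l • e 3 + (l ^ 2 - b) • e 4, e 3 - l • e 4, e 4, e 5] (fun x hx => ?_) fun x y => ?_ <;>
    simp only [chain, ofTable_cons, ofTable_nil, Fin.sum_univ_six, Matrix.cons_val, e_eq_vec,
      smul_vec, add_vec, sub_vec, vec_eq_vec_iff] at * <;>
    grind

theorem isomorphic_chain_of_xs {a l : ℂ} (b : ℂ) (hl : l ≠ a) :
    Isomorphic (chain a b l 1 0) (chain a 0 l 1 0) := by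
  refine isomorphic_of_rows ![e 0, e 1 - (b / (l - a)) • e 2, e 2 - (b / (l - a)) • e 3,
    e 3 - (b / (l - a)) • e 4, e 4 - (b / (l - a)) • e 5, e 5] (fun x hx => ?_) fun x y => ?_ <;>
    simp only [chain, ofTable_cons, ofTable_nil, Fin.sum_univ_six, Matrix.cons_val, e_eq_vec,
      smul_vec, add_vec, sub_vec, vec_eq_vec_iff] at * <;>
    grind

theorem isomorphic_chain_T01 :
    Isomorphic (chain 1 0 (-1) 0 0) Name.T01.product := by
  refine isomorphic_of_rows ![e 0, e 1, e 2, e 3, e 4, -e 5] (fun x hx => ?_) fun x y => ?_ <;>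
    simp only [chain, Name.product_eq_ofTable, Name.table, ofTable_cons, ofTable_nil,
      Fin.sum_univ_six, Matrix.cons_val, e_eq_vec, smul_vec, add_vec, neg_vec, vec_eq_vec_iff] at *
      <;>
    grind

theorem isomorphic_T18_neg_one_T01 : Isomorphic (Name.T18 (-1)).product Name.T01.product := by
  rw [Name.product_T18, neg_add_cancel]
  exact isomorphic_chain_T01

theorem isListed_chain_of_ys (a b l n : ℂ) : IsListed (chain a b l n 1) := by
  refine (isomorphic_chain_of_ys a b l n).isListed
    ((isomorphic_chain_of_ys_reduced _ _ _).isListed ?_)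
  rcases eq_or_ne a 0 with rfl | ha
  · exact ⟨.T16, trivial, Name.product_T16 ▸ Isomorphic.refl _⟩
  · have h := isomorphic_chain_scale a 0 0 0 1 (β := 1 / a) (δ := (1 / a) ^ 2)
      (by simp [ha]) (by simp [ha])
    refine ⟨.T17, trivial, ?_⟩
    simpa [Name.product_T17, ha] using h

theorem isListed_chain_of_xs {a l : ℂ} (b : ℂ) (hl : l ≠ a) : IsListed (chain a b l 1 0) := by
  refine (isomorphic_chain_of_xs b hl).isListed ?_
  rcases eq_or_ne a 0 with rfl | ha
  · have h := isomorphic_chain_scale 0 0 l 1 0 (β := 1 / l) (δ := 1 / l) (by simp [hl])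
      (by simp [hl])
    refine ⟨.T15, trivial, ?_⟩
    rw [Name.product_T15]
    convert h using 2 <;> field_simp <;> simp
  · have hl' : a - l ≠ 0 := sub_ne_zero.mpr hl.symm
    have h := isomorphic_chain_scale a 0 l 1 0 (β := 1 / a) (δ := (a - l) / a ^ 2)
      (by simp [ha]) (by simp [ha, hl'])
    refine ⟨.T18 (l / (a - l)), ?_, ?_⟩
    · intro h
      rw [div_eq_iff hl'] at h
      exact ha (by linear_combination h)
    · rw [Name.product_T18]
      convert h using 2 <;> field_simp <;> ring

theorem isMalcev_chain (a b n : ℂ) : IsMalcev (chain a b (a * n) n 0) := by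
  refine ⟨isAnticommutative_ofTable _, fun x y z => ?_⟩
  simp only [jacobian, chain, ofTable_cons, ofTable_nil, Matrix.cons_val, e_eq_vec, smul_vec,
    add_vec, vec_eq_vec_iff]
  grind

theorem isListed_chain {a b l n m : ℂ} (h : n ≠ 0 ∨ m ≠ 0)
    (hM : ¬ IsMalcev (chain a b l n m)) : IsListed (chain a b l n m) := by
  rcases eq_or_ne m 0 with rfl | hm
  · have hn : n ≠ 0 := h.resolve_right (not_not.mpr rfl)
    have scale := isomorphic_chain_scale a b l n 0 one_ne_zero hn
    simp only [one_pow, one_mul, div_self hn, zero_div] at scale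
    refine scale.isListed (isListed_chain_of_xs _ fun hl => hM ?_)
    obtain rfl : l = a * n := (div_eq_iff hn).mp hl
    exact isMalcev_chain a b n
  · have scale := isomorphic_chain_scale a b l n m one_ne_zero hm
    simp only [one_pow, one_mul, div_self hm] at scale
    exact scale.isListed (isListed_chain_of_ys ..)

/-! ### The lower central series -/

section LowerCentralSeries

variable {V : Type*} [AddCommGroup V] [Module ℂ V] {μ : Product V} {n : ℕ}

/-- The lower central series of an algebra, starting with the whole algebra in degree `0`. It is
formed with multiplications from the left, which suffices for anticommutative algebras. -/
def lcs (μ : Product V) : ℕ → Submodule ℂ V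
  | 0 => ⊤
  | n + 1 => Submodule.map₂ μ ⊤ (lcs μ n)

theorem lcs_succ_le_iff {S : Submodule ℂ V} :
    lcs μ (n + 1) ≤ S ↔ ∀ a, ∀ b ∈ lcs μ n, μ a b ∈ S := by
  simp [lcs, Submodule.map₂_le]

theorem mul_mem_lcs (a : V) {b : V} (hb : b ∈ lcs μ n) : μ a b ∈ lcs μ (n + 1) :=
  Submodule.apply_mem_map₂ _ Submodule.mem_top hb

theorem mul_mem_lcs_one (a b : V) : μ a b ∈ lcs μ 1 :=
  mul_mem_lcs a (Submodule.mem_top (x := b))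

theorem antitone_lcs (μ : Product V) : Antitone (lcs μ) := by
  refine antitone_nat_of_succ_le fun n => ?_
  induction n with
  | zero => exact le_top
  | succ n ih => exact Submodule.map₂_le_map₂_right ih

theorem lcs_le_span (μ : Product V) (n : ℕ) :
    lcs μ n ≤ Submodule.span ℂ {v | IsProductOf μ (n + 1) v} := by
  induction n with
  | zero => exact fun v _ => Submodule.subset_span (IsProductOf.single v)
  | succ n ih =>
    refine lcs_succ_le_iff.mpr fun a b hb => ?_
    refine (Submodule.span_le (p := (Submodule.span ℂ _).comap (μ a))).mpr (fun v hv => ?_) (ih hb)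
    rw [add_comm (n + 1) 1]
    exact Submodule.subset_span (IsProductOf.mul (IsProductOf.single a) hv)

theorem IsNilpotent.exists_lcs_eq_bot (hN : IsNilpotent μ) : ∃ n, lcs μ n = ⊥ := by
  obtain ⟨n, hn, h⟩ := hN
  obtain ⟨m, rfl⟩ := Nat.exists_eq_add_of_le' hn
  exact ⟨m, eq_bot_iff.mpr ((lcs_le_span μ m).trans (Submodule.span_le.mpr h))⟩

theorem IsNilpotent.lcs_eq_bot_of_le (hN : IsNilpotent μ) (hn : lcs μ n ≤ lcs μ (n + 1)) :
    lcs μ n = ⊥ := by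
  have hle (k : ℕ) : lcs μ n ≤ lcs μ (n + k) := by
    induction k with
    | zero => exact le_rfl
    | succ k ih => exact hn.trans (Submodule.map₂_le_map₂_right ih)
  obtain ⟨m, hm⟩ := hN.exists_lcs_eq_bot
  exact eq_bot_iff.mpr ((hle m).trans ((antitone_lcs μ (Nat.le_add_left m n)).trans hm.le))

theorem IsNilpotent.finrank_lcs_succ_lt [FiniteDimensional ℂ V] (hN : IsNilpotent μ)
    (hn : lcs μ n ≠ ⊥) : Module.finrank ℂ (lcs μ (n + 1)) < Module.finrank ℂ (lcs μ n) :=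
  Submodule.finrank_lt_finrank_of_lt
    ((antitone_lcs μ n.le_succ).lt_of_not_ge fun h => hn (hN.lcs_eq_bot_of_le h))

theorem IsAnticommutative.mul_mem_lcs (hμ : IsAnticommutative μ) {a : V} (ha : a ∈ lcs μ n)
    (b : V) : μ a b ∈ lcs μ (n + 1) := by
  rw [hμ]
  exact neg_mem (Tortkara.mul_mem_lcs b ha)

end LowerCentralSeries

section TortkaraIdentity

variable {V : Type*} [AddCommGroup V] [Module ℂ V] {μ : Product V}

theorem jacobian_swap (hμ : IsAnticommutative μ) (a b c : V) :
    jacobian μ b a c = -jacobian μ a b c := by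
  simp only [jacobian, hμ b a, hμ a c, hμ c b, map_neg, LinearMap.neg_apply]
  abel

theorem jacobian_rotate (a b c : V) : jacobian μ b c a = jacobian μ a b c := by
  simp only [jacobian]
  abel

theorem jacobian_mem_lcs_two (hμ : IsAnticommutative μ) (a b c : V) :
    jacobian μ a b c ∈ lcs μ 2 :=
  add_mem (add_mem (hμ.mul_mem_lcs (mul_mem_lcs_one _ _) _)
    (hμ.mul_mem_lcs (mul_mem_lcs_one _ _) _)) (hμ.mul_mem_lcs (mul_mem_lcs_one _ _) _)

namespace IsTortkara

theorem mul_mul_mul (hT : IsTortkara μ) (a b c : V) :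
    μ (μ a b) (μ a c) = -μ (jacobian μ a b c) a := by
  rw [hT.1 a b, hT.1 a c, map_neg, map_neg, LinearMap.neg_apply, neg_neg, hT.2 b a c,
    jacobian_swap hT.1, map_neg, LinearMap.neg_apply]

theorem linearized (hT : IsTortkara μ) (a b b' c : V) :
    μ (μ a b) (μ c b') + μ (μ a b') (μ c b) =
      μ (jacobian μ a b c) b' + μ (jacobian μ a b' c) b := by
  have h₁ := hT.2 a (b + b') c
  have h₂ := hT.2 a b c
  have h₃ := hT.2 a b' c
  simp only [jacobian, map_add, LinearMap.add_apply] at *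
  linear_combination (norm := module) h₁ - h₂ - h₃

-- Modulo `lcs μ 3`, the product `(ab)(cd)` is antisymmetric under all three transpositions
-- `(ab)`, `(cd)` and `(bd)`, hence alternating, but it also changes its sign under the even
-- permutation `(ac)(bd)`.
theorem mul_mem_lcs_three (hT : IsTortkara μ) {a b : V} (ha : a ∈ lcs μ 1) (hb : b ∈ lcs μ 1) :
    μ a b ∈ lcs μ 3 := by
  have hμ := hT.1
  have antisymm (a b c d : V) : μ (μ a b) (μ c d) + μ (μ a d) (μ c b) ∈ lcs μ 3 := by
    rw [hT.linearized]
    exact add_mem (hμ.mul_mem_lcs (jacobian_mem_lcs_two hμ _ _ _) _)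
      (hμ.mul_mem_lcs (jacobian_mem_lcs_two hμ _ _ _) _)
  refine (lcs_succ_le_iff (S := (lcs μ 3).comap (μ.flip b))).mpr (fun a₁ a₂ _ => ?_) ha
  refine (lcs_succ_le_iff (S := (lcs μ 3).comap (μ (μ a₁ a₂)))).mpr (fun b₁ b₂ _ => ?_) hb
  have h : μ (μ a₁ a₂) (μ b₁ b₂) = (1 / 2 : ℂ) • (μ (μ a₁ a₂) (μ b₁ b₂) + μ (μ a₁ b₂) (μ b₁ a₂) -
      (μ (μ b₂ a₁) (μ a₂ b₁) + μ (μ b₂ b₁) (μ a₂ a₁))) := by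
    simp only [hμ b₂ a₁, hμ a₂ b₁, hμ b₂ b₁, hμ a₂ a₁, hμ (μ b₁ b₂), map_neg,
      LinearMap.neg_apply]
    module
  rw [Submodule.mem_comap, h]
  exact Submodule.smul_mem _ _ (sub_mem (antisymm _ _ _ _) (antisymm _ _ _ _))

theorem jacobian_mem_lcs_three (hT : IsTortkara μ) (a b : V) {c : V} (hc : c ∈ lcs μ 1) :
    jacobian μ a b c ∈ lcs μ 3 :=
  add_mem (add_mem (hT.mul_mem_lcs_three (mul_mem_lcs_one _ _) hc)
    (hT.1.mul_mem_lcs (mul_mem_lcs _ hc) _)) (hT.1.mul_mem_lcs (hT.1.mul_mem_lcs hc _) _)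

end IsTortkara

-- On the pairs among five letters, the relation `h` says that `H` is, up to signs, an eigenvector
-- of the Petersen graph for the eigenvalue 2; but its eigenvalues are 3, 1 and -2.
theorem eq_zero_of_alternating_of_two_smul_eq {ι Q : Type*} [AddCommGroup Q] [Module ℂ Q]
    {H : ι → ι → ι → ι → ι → Q} (h₁ : ∀ a b c p q, H b a c p q = -H a b c p q)
    (h₂ : ∀ a b c p q, H a c b p q = -H a b c p q) (h₃ : ∀ a b c p q, H a b c q p = -H a b c p q)
    (h : ∀ a b c p q, (2 : ℂ) • H a b c p q = H p q c a b + H p q a b c + H p q b c a)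
    (a b c p q : ι) : H a b c p q = 0 := by
  have rotate (a b c p q) : H b c a p q = H a b c p q := by rw [h₂, h₁, neg_neg]
  have distant (a b c p q) : H a b c p q = H a b p q c + H a b q c p + H b c p q a +
      H b c q a p + H c a p q b + H c a q b p := by
    linear_combination (norm := module) (2 : ℂ) • h a b c p q + h p q c a b + h p q a b c +
      h p q b c a + (2 : ℂ) • rotate a b c p q + rotate b c a p q
  have adjacent (a b c p q) : H p q c a b = H a b c p q := by
    have h₄ : H q c b p a = H b c q a p := by rw [h₁, rotate b c q, h₃, neg_neg]
    have h₅ : H c p a b q = H c a p q b := by rw [h₂, h₃, neg_neg]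
    linear_combination (norm := module) (-(1 / 4) : ℂ) • (distant a b c p q - distant p q c a b +
      h a b c p q - h p q c a b - rotate b c p q a - h₄ - h₅ + rotate q c a b p)
  linear_combination (norm := module) -h a b c p q - adjacent a b c p q - adjacent b c a p q -
    adjacent c a b p q - (2 : ℂ) • rotate a b c p q - rotate b c a p q

namespace IsTortkara

theorem mul_mul_add_swap_mem_lcs_four (hT : IsTortkara μ) (a b c : V) {q : V} (hq : q ∈ lcs μ 1) :
    μ (μ a b) (μ c q) + μ (μ a c) (μ b q) ∈ lcs μ 4 := by
  have h := hT.linearized q b c a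
  rw [hT.1 q, hT.1 q, hT.1 (-μ b q), hT.1 (-μ c q), map_neg, map_neg, neg_neg, neg_neg] at h
  rw [add_comm, h, ← jacobian_rotate, ← jacobian_rotate q c]
  exact add_mem (hT.1.mul_mem_lcs (hT.jacobian_mem_lcs_three _ _ hq) _)
    (hT.1.mul_mem_lcs (hT.jacobian_mem_lcs_three _ _ hq) _)

theorem two_smul_mul_mul_sub_mem_lcs_four (hT : IsTortkara μ) (a b c : V) {q : V}
    (hq : q ∈ lcs μ 1) :
    (2 : ℂ) • μ (μ a b) (μ c q) - (μ q (μ c (μ a b)) + μ q (μ a (μ b c)) + μ q (μ b (μ c a))) ∈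
      lcs μ 4 := by
  have hμ := hT.1
  have h : (2 : ℂ) • μ (μ a b) (μ c q) -
      (μ q (μ c (μ a b)) + μ q (μ a (μ b c)) + μ q (μ b (μ c a))) =
      μ (jacobian μ a q c) b - (μ (μ b a) (μ c q) + μ (μ b c) (μ a q)) := by
    have hJ : μ (jacobian μ a b c) q =
        μ q (μ c (μ a b)) + μ q (μ a (μ b c)) + μ q (μ b (μ c a)) := by
      simp only [hμ _ q, jacobian, hμ (μ a b) c, hμ (μ b c) a, hμ (μ c a) b, map_add, map_neg,
        LinearMap.neg_apply, LinearMap.add_apply, neg_neg]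
    have h := hT.linearized a b q c
    rw [hJ, hμ (μ a q), hμ c b, map_neg, LinearMap.neg_apply, neg_neg] at h
    rw [hμ b a, map_neg, LinearMap.neg_apply]
    linear_combination (norm := module) h
  rw [h, ← jacobian_rotate, ← jacobian_rotate]
  exact sub_mem (hμ.mul_mem_lcs (hT.jacobian_mem_lcs_three _ _ hq) _)
    (hT.mul_mul_add_swap_mem_lcs_four _ _ _ hq)

theorem mul_mem_lcs_four (hT : IsTortkara μ) {a b : V} (ha : a ∈ lcs μ 1) (hb : b ∈ lcs μ 2) :
    μ a b ∈ lcs μ 4 := by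
  have hμ := hT.1
  refine (lcs_succ_le_iff (S := (lcs μ 4).comap (μ.flip b))).mpr (fun a₁ a₂ _ => ?_) ha
  refine (lcs_succ_le_iff (S := (lcs μ 4).comap (μ (μ a₁ a₂)))).mpr (fun c d hd => ?_) hb
  refine (lcs_succ_le_iff (S := (lcs μ 4).comap (μ (μ a₁ a₂) ∘ₗ μ c))).mpr (fun p q _ => ?_) hd
  have mkQ_eq_zero {v : V} (hv : v ∈ lcs μ 4) : (lcs μ 4).mkQ v = 0 :=
    (Submodule.Quotient.mk_eq_zero _).mpr hv
  rw [Submodule.mem_comap, LinearMap.comp_apply]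
  refine (Submodule.Quotient.mk_eq_zero _).mp (eq_zero_of_alternating_of_two_smul_eq
    (H := fun a b c p q => (lcs μ 4).mkQ (μ (μ a b) (μ c (μ p q)))) (fun a b c p q => ?_)
    (fun a b c p q => ?_) (fun a b c p q => ?_) (fun a b c p q => ?_) a₁ a₂ c p q)
  · rw [hμ b a, map_neg, LinearMap.neg_apply, map_neg]
  · rw [eq_neg_iff_add_eq_zero, ← map_add]
    exact mkQ_eq_zero (hT.mul_mul_add_swap_mem_lcs_four a c b (mul_mem_lcs_one p q))
  · rw [hμ q p, map_neg, map_neg, map_neg]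
  · rw [← map_smul, ← map_add, ← map_add, ← sub_eq_zero, ← map_sub]
    exact mkQ_eq_zero (hT.two_smul_mul_mul_sub_mem_lcs_four a b c (mul_mem_lcs_one p q))

end IsTortkara

end TortkaraIdentity

section Spanning

variable {V : Type*} [AddCommGroup V] [Module ℂ V] {μ : Product V} {n : ℕ} {s s' g : Set V}

/-- The set `s` is contained in `lcs μ n` and spans it modulo `lcs μ (n + 1)`. For `n = 0` this says
that `s` generates the algebra, if the latter is nilpotent. -/
structure SpansLcs (μ : Product V) (n : ℕ) (s : Set V) : Prop where
  subset : s ⊆ lcs μ n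
  le_sup : lcs μ n ≤ Submodule.span ℂ s ⊔ lcs μ (n + 1)

namespace SpansLcs

theorem zero_of_span_le (h : SpansLcs μ 0 s) (hs : Submodule.span ℂ s ≤ Submodule.span ℂ s') :
    SpansLcs μ 0 s' :=
  ⟨fun _ _ => Submodule.mem_top, h.le_sup.trans (sup_le_sup_right hs _)⟩

theorem lcs_le (h : SpansLcs μ n s) {S : Submodule ℂ V} (hs : s ⊆ S) (hS : lcs μ (n + 1) ≤ S) :
    lcs μ n ≤ S :=
  h.le_sup.trans (sup_le (Submodule.span_le.mpr hs) hS)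

theorem mem {w : V} (h : SpansLcs μ n {w}) : w ∈ lcs μ n :=
  h.subset rfl

theorem exists_sub_smul_mem {w v : V} (h : SpansLcs μ n {w}) (hv : v ∈ lcs μ n) :
    ∃ c : ℂ, v - c • w ∈ lcs μ (n + 1) := by
  obtain ⟨a, ha, b, hb, rfl⟩ := Submodule.mem_sup.mp (h.le_sup hv)
  obtain ⟨c, rfl⟩ := Submodule.mem_span_singleton.mp ha
  exact ⟨c, by rwa [add_sub_cancel_left]⟩

theorem exists_eq_smul {u v : V} (h : SpansLcs μ n {u}) (hn : lcs μ (n + 1) = ⊥)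
    (hv : v ∈ lcs μ n) : ∃ c : ℂ, v = c • u := by
  obtain ⟨c, hc⟩ := h.exists_sub_smul_mem hv
  exact ⟨c, sub_eq_zero.mp (by rwa [hn, Submodule.mem_bot] at hc)⟩

theorem exists_eq_smul_add_smul {w u v : V} (h : SpansLcs μ n {w}) (h' : SpansLcs μ (n + 1) {u})
    (hn : lcs μ (n + 2) = ⊥) (hv : v ∈ lcs μ n) : ∃ c d : ℂ, v = c • w + d • u := by
  obtain ⟨c, hc⟩ := h.exists_sub_smul_mem hv
  obtain ⟨d, hd⟩ := h'.exists_eq_smul hn hc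
  exact ⟨c, d, by rw [← hd, add_sub_cancel]⟩

theorem succ (hg : SpansLcs μ 0 g) (hs : SpansLcs μ n s)
    (h : ∀ a ∈ lcs μ 1, ∀ b ∈ lcs μ n, μ a b ∈ lcs μ (n + 2)) :
    SpansLcs μ (n + 1) (Set.image2 (fun a b => μ a b) g s) := by
  refine ⟨Set.image2_subset_iff.mpr fun a _ b hb => mul_mem_lcs a (hs.subset hb), ?_⟩
  calc lcs μ (n + 1) ≤ Submodule.map₂ μ (Submodule.span ℂ g ⊔ lcs μ 1) (lcs μ n) :=
        Submodule.map₂_le_map₂_left hg.le_sup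
    _ ≤ Submodule.map₂ μ (Submodule.span ℂ g) (Submodule.span ℂ s ⊔ lcs μ (n + 1)) ⊔
        Submodule.map₂ μ (lcs μ 1) (lcs μ n) := by
        rw [Submodule.map₂_sup_left]
        exact sup_le_sup_right (Submodule.map₂_le_map₂_right hs.le_sup) _
    _ ≤ Submodule.span ℂ (Set.image2 (fun a b => μ a b) g s) ⊔ lcs μ (n + 2) := by
        rw [Submodule.map₂_sup_right, Submodule.map₂_span_span, sup_assoc]
        exact sup_le_sup_left
          (sup_le (Submodule.map₂_le_map₂_left le_top) (Submodule.map₂_le.mpr h)) _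

theorem lcs_succ_le (hg : SpansLcs μ 0 g) {S : Submodule ℂ V}
    (h : ∀ a ∈ g, ∀ b ∈ lcs μ n, μ a b ∈ S)
    (h₁ : ∀ a ∈ lcs μ 1, ∀ b ∈ lcs μ n, μ a b ∈ S) : lcs μ (n + 1) ≤ S :=
  Tortkara.lcs_succ_le_iff.mpr fun a b hb => hg.lcs_le (S := S.comap (μ.flip b))
    (fun c hc => h c hc b hb) (fun c hc => h₁ c hc b hb) (Submodule.mem_top (x := a))

theorem mul_mem_lcs_add_two {w : V} (h : SpansLcs μ n {w}) (hμ : IsAnticommutative μ) {a b : V}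
    (ha : a ∈ lcs μ n) (hb : b ∈ lcs μ n) : μ a b ∈ lcs μ (n + 2) := by
  obtain ⟨c, hc⟩ := h.exists_sub_smul_mem ha
  obtain ⟨d, hd⟩ := h.exists_sub_smul_mem hb
  have hab : μ a b = c • μ w (b - d • w) + μ (a - c • w) b := by simp [hμ.mul_self]
  rw [hab]
  exact add_mem (Submodule.smul_mem _ _ (mul_mem_lcs w hd)) (hμ.mul_mem_lcs hc b)

end SpansLcs

variable [FiniteDimensional ℂ V]

theorem spansLcs_singleton {w : V} (hw : w ∈ lcs μ n) (hw' : w ∉ lcs μ (n + 1))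
    (h : Module.finrank ℂ (lcs μ n) ≤ Module.finrank ℂ (lcs μ (n + 1)) + 1) :
    SpansLcs μ n {w} := by
  have hle : Submodule.span ℂ {w} ⊔ lcs μ (n + 1) ≤ lcs μ n :=
    sup_le ((Submodule.span_singleton_le_iff_mem _ _).mpr hw) (antitone_lcs μ n.le_succ)
  have hlt : lcs μ (n + 1) < Submodule.span ℂ {w} ⊔ lcs μ (n + 1) :=
    right_lt_sup.mpr fun h => hw' (h (Submodule.mem_span_singleton_self w))
  exact ⟨Set.singleton_subset_iff.mpr hw, (Submodule.eq_of_le_of_finrank_le hle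
    (h.trans (Submodule.finrank_lt_finrank_of_lt hlt))).ge⟩

theorem spansLcs_singleton_of_ne_zero {u : V} (hu : u ∈ lcs μ n) (hu' : u ≠ 0)
    (hn : lcs μ (n + 1) = ⊥) (h : Module.finrank ℂ (lcs μ n) ≤ 1) : SpansLcs μ n {u} :=
  spansLcs_singleton hu (by rwa [hn]) (by lia)

theorem exists_spansLcs_zero (μ : Product V) {k : ℕ}
    (h : Module.finrank ℂ V = Module.finrank ℂ (lcs μ 1) + k) :
    ∃ g : Fin k → V, SpansLcs μ 0 (Set.range g) := by
  obtain ⟨C, hC⟩ := (lcs μ 1).exists_isCompl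
  have hCk := Submodule.finrank_add_eq_of_isCompl hC
  let b := Module.finBasisOfFinrankEq ℂ C (n := k) (by lia)
  refine ⟨fun i => b i, fun _ _ => Submodule.mem_top, ?_⟩
  have hspan : Submodule.span ℂ (Set.range fun i => (b i : V)) = C := by
    rw [← Function.comp_def, ← Submodule.coe_subtype, Set.range_comp, Submodule.span_image,
      b.span_eq, Submodule.map_top, Submodule.range_subtype]
  rw [hspan, hC.symm.sup_eq_top]
  exact le_top

theorem SpansLcs.finrank_le {w : V} (h : SpansLcs μ n {w}) :
    Module.finrank ℂ (lcs μ n) ≤ Module.finrank ℂ (lcs μ (n + 1)) + 1 := by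
  have h₁ := Submodule.finrank_mono h.le_sup
  have h₂ := Submodule.finrank_add_le_finrank_add_finrank (Submodule.span ℂ {w}) (lcs μ (n + 1))
  have h₃ : Module.finrank ℂ (Submodule.span ℂ {w}) ≤ 1 := by
    simpa using finrank_span_le_card (R := ℂ) {w}
  lia

theorem finrank_lcs_one_add_two_le (hμ : IsAnticommutative μ) (hN : IsNilpotent μ)
    (h : lcs μ 1 ≠ ⊥) : Module.finrank ℂ (lcs μ 1) + 2 ≤ Module.finrank ℂ V := by
  have hlt : Module.finrank ℂ (lcs μ 1) < Module.finrank ℂ V := by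
    rw [← finrank_top ℂ V]
    exact hN.finrank_lcs_succ_lt (n := 0)
      (ne_bot_of_le_ne_bot h (antitone_lcs μ (Nat.zero_le 1)))
  by_contra! hlt'
  obtain ⟨g, hg⟩ := exists_spansLcs_zero μ (k := 1) (by lia)
  have h₁ := hg.succ hg fun a ha b _ => hμ.mul_mem_lcs ha b
  refine h (hN.lcs_eq_bot_of_le (h₁.lcs_le ?_ le_rfl))
  rintro _ ⟨_, ⟨i, rfl⟩, _, ⟨j, rfl⟩, rfl⟩
  rw [Subsingleton.elim i j]
  simp [hμ.mul_self]

end Spanning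

/-! ### Completeness of the list -/

section Generators

variable {V : Type*} [AddCommGroup V] [Module ℂ V] {μ : Product V} {x y t z : V}

theorem IsTortkara.lcs_three_ne_bot (hT : IsTortkara μ) (hM : ¬ IsMalcev μ) : lcs μ 3 ≠ ⊥ := by
  refine fun h => hM ⟨hT.1, fun a b c => ?_⟩
  have eq_zero {v : V} (hv : v ∈ lcs μ 3) : v = 0 := by rwa [h, Submodule.mem_bot] at hv
  rw [eq_zero (hT.jacobian_mem_lcs_three _ _ (mul_mem_lcs_one _ _)),
    eq_zero (hT.1.mul_mem_lcs (jacobian_mem_lcs_two hT.1 _ _ _) _)]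

theorem SpansLcs.mul_mem_lcs_four (hz : SpansLcs μ 1 {z}) (hT : IsTortkara μ) {a b : V}
    (ha : a ∈ lcs μ 1) (hb : b ∈ lcs μ 1) : μ a b ∈ lcs μ 4 := by
  obtain ⟨c, hc⟩ := hz.exists_sub_smul_mem ha
  obtain ⟨d, hd⟩ := hz.exists_sub_smul_mem hb
  have hab : μ a b = d • μ a z + μ a (b - d • z) := by simp
  have haz : μ a z = -μ z (a - c • z) := by simp [hT.1.mul_self, ← hT.1 a z]
  rw [hab, haz]
  exact add_mem (Submodule.smul_mem _ _ (neg_mem (hT.mul_mem_lcs_four hz.mem hc)))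
    (hT.mul_mem_lcs_four ha hd)

theorem SpansLcs.exists_span_pair_eq [FiniteDimensional ℂ V] (hμ : IsAnticommutative μ)
    (hz : SpansLcs μ 1 {μ x y})
    (hfin : Module.finrank ℂ (lcs μ 2) ≤ Module.finrank ℂ (lcs μ 3) + 1)
    (h : ¬ (μ x (μ x y) ∈ lcs μ 3 ∧ μ y (μ x y) ∈ lcs μ 3)) :
    ∃ x' y', Submodule.span ℂ {x', y'} = Submodule.span ℂ {x, y} ∧ SpansLcs μ 1 {μ x' y'} ∧
      SpansLcs μ 2 {μ x' (μ x' y')} ∧ μ y' (μ x' y') ∈ lcs μ 3 := by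
  by_cases hxz : μ x (μ x y) ∈ lcs μ 3
  · have hyz := fun hyz => h ⟨hxz, hyz⟩
    have hz' : μ y (-x) = μ x y := by rw [map_neg, ← hμ]
    refine ⟨y, -x, ?_, by rwa [hz'], ?_, ?_⟩
    · rw [Submodule.span_insert, ← Set.neg_singleton, Submodule.span_neg, sup_comm,
        ← Submodule.span_insert]
    · rw [hz']
      exact spansLcs_singleton (mul_mem_lcs y hz.mem) hyz hfin
    · rw [hz', map_neg, LinearMap.neg_apply]
      exact neg_mem hxz
  · have hw := spansLcs_singleton (mul_mem_lcs x hz.mem) hxz hfin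
    obtain ⟨c, hc⟩ := hw.exists_sub_smul_mem (mul_mem_lcs y hz.mem)
    have hz' : μ x (y - c • x) = μ x y := by simp [hμ.mul_self]
    refine ⟨x, y - c • x, ?_, by rwa [hz'], by rwa [hz'], ?_⟩
    · refine le_antisymm ?_ ?_ <;> simp only [Submodule.span_le, Set.pair_subset_iff,
        SetLike.mem_coe, Submodule.mem_span_pair]
      · exact ⟨⟨1, 0, by module⟩, ⟨-c, 1, by module⟩⟩
      · exact ⟨⟨1, 0, by module⟩, ⟨c, 1, by module⟩⟩
    · rw [hz']
      simpa using hc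

theorem IsTortkara.mul_jacobian_mem_lcs_four (hT : IsTortkara μ) {a c : V} (b : V)
    (h : μ a c ∈ lcs μ 2) : μ a (jacobian μ a b c) ∈ lcs μ 4 := by
  rw [hT.1, ← hT.mul_mul_mul]
  exact hT.mul_mem_lcs_four (mul_mem_lcs_one _ _) h

end Generators

section ThreeGenerators

variable {V : Type*} [AddCommGroup V] [Module ℂ V] {μ : Product V} {x y t z w u : V}

theorem exists_spansLcs_one_mul [FiniteDimensional ℂ V] (hμ : IsAnticommutative μ)
    (hN : IsNilpotent μ) (hV : Module.finrank ℂ V = Module.finrank ℂ (lcs μ 1) + 3)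
    (h₁ : lcs μ 1 ≠ ⊥) (hfin : Module.finrank ℂ (lcs μ 1) ≤ Module.finrank ℂ (lcs μ 2) + 1) :
    ∃ x y t, SpansLcs μ 0 {x, y, t} ∧ SpansLcs μ 1 {μ x y} := by
  obtain ⟨g, hg⟩ := exists_spansLcs_zero μ hV
  have hgg := hg.succ hg fun a ha b _ => hμ.mul_mem_lcs ha b
  obtain ⟨i, j, hij⟩ : ∃ i j, μ (g i) (g j) ∉ lcs μ 2 := by
    by_contra! h
    refine h₁ (hN.lcs_eq_bot_of_le (hgg.lcs_le ?_ le_rfl))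
    rintro _ ⟨_, ⟨i, rfl⟩, _, ⟨j, rfl⟩, rfl⟩
    exact h i j
  have hne : i ≠ j := by
    rintro rfl
    exact hij (by rw [hμ.mul_self]; exact zero_mem _)
  have third : ∀ i j : Fin 3, i ≠ j → ∃ k, ∀ l, l = i ∨ l = j ∨ l = k := by decide
  obtain ⟨k, hk⟩ := third i j hne
  refine ⟨g i, g j, g k, hg.zero_of_span_le (Submodule.span_mono ?_),
    spansLcs_singleton (mul_mem_lcs_one _ _) hij hfin⟩
  rintro _ ⟨l, rfl⟩
  rcases hk l with rfl | rfl | rfl <;> simp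

theorem exists_adapted_generators [FiniteDimensional ℂ V] (hμ : IsAnticommutative μ)
    (hN : IsNilpotent μ) (hV : Module.finrank ℂ V = Module.finrank ℂ (lcs μ 1) + 3)
    (h₁ : lcs μ 1 ≠ ⊥) (hfin : Module.finrank ℂ (lcs μ 1) ≤ Module.finrank ℂ (lcs μ 2) + 1) :
    ∃ x y t, SpansLcs μ 0 {x, y, t} ∧ SpansLcs μ 1 {μ x y} ∧ μ x t ∈ lcs μ 2 ∧ μ y t ∈ lcs μ 2 := by
  obtain ⟨x, y, t, hg, hz⟩ := exists_spansLcs_one_mul hμ hN hV h₁ hfin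
  obtain ⟨c, hc⟩ := hz.exists_sub_smul_mem (mul_mem_lcs_one x t)
  obtain ⟨d, hd⟩ := hz.exists_sub_smul_mem (mul_mem_lcs_one y t)
  refine ⟨x, y, t - c • y + d • x, hg.zero_of_span_le ?_, hz, ?_, ?_⟩
  · simp only [Submodule.span_le, Set.insert_subset_iff, Set.singleton_subset_iff,
      SetLike.mem_coe, Submodule.mem_span_triple]
    exact ⟨⟨1, 0, 0, by module⟩, ⟨0, 1, 0, by module⟩, ⟨-d, c, 1, by module⟩⟩
  · simpa [hμ.mul_self] using hc
  · simpa [hμ.mul_self, hμ y x, sub_eq_add_neg] using hd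

theorem mul_mem_lcs_three_of_adapted (hT : IsTortkara μ) (hN : IsNilpotent μ)
    [FiniteDimensional ℂ V] (hg : SpansLcs μ 0 {x, y, t}) (hxt : μ x t ∈ lcs μ 2)
    (hyt : μ y t ∈ lcs μ 2) (h₃ : lcs μ 3 ≠ ⊥)
    (hfin : Module.finrank ℂ (lcs μ 2) ≤ Module.finrank ℂ (lcs μ 3) + 1) :
    μ t (μ x y) ∈ lcs μ 3 := by
  have hμ := hT.1
  by_contra htz
  have hw := spansLcs_singleton (mul_mem_lcs t (mul_mem_lcs_one x y)) htz hfin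
  have h₂ := hg.succ hw fun a ha b hb => hT.mul_mem_lcs_four ha hb
  have mul_mem_of_mul_jacobian_mem {v : V} (hv : μ v (jacobian μ x y t) ∈ lcs μ 4) :
      μ v (μ t (μ x y)) ∈ lcs μ 4 := by
    have h : μ t (μ x y) = μ y (μ x t) - μ x (μ y t) - jacobian μ x y t := by
      rw [jacobian, hμ (μ y t) x, hμ t x, map_neg, LinearMap.neg_apply, hμ (μ x y) t, hμ (μ x t) y]
      abel
    rw [h, map_sub]
    exact sub_mem (mul_mem_lcs v (sub_mem (mul_mem_lcs y hxt) (mul_mem_lcs x hyt))) hv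
  refine h₃ (hN.lcs_eq_bot_of_le (h₂.lcs_le ?_ le_rfl))
  rintro _ ⟨v, rfl | rfl | rfl, _, rfl, rfl⟩
  · exact mul_mem_of_mul_jacobian_mem (hT.mul_jacobian_mem_lcs_four _ hxt)
  · refine mul_mem_of_mul_jacobian_mem ?_
    rw [← neg_neg (jacobian μ x v t), ← jacobian_swap hμ, map_neg]
    exact neg_mem (hT.mul_jacobian_mem_lcs_four _ hyt)
  · refine mul_mem_of_mul_jacobian_mem ?_
    rw [← jacobian_rotate, ← jacobian_rotate]
    exact hT.mul_jacobian_mem_lcs_four _ (by rw [hμ]; exact neg_mem hyt)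

theorem exists_three_generators [FiniteDimensional ℂ V] (hT : IsTortkara μ)
    (hN : IsNilpotent μ) (hV : Module.finrank ℂ V = Module.finrank ℂ (lcs μ 1) + 3)
    (h₃ : lcs μ 3 ≠ ⊥) (hfin₁ : Module.finrank ℂ (lcs μ 1) ≤ Module.finrank ℂ (lcs μ 2) + 1)
    (hfin₂ : Module.finrank ℂ (lcs μ 2) ≤ Module.finrank ℂ (lcs μ 3) + 1) :
    ∃ x y t, SpansLcs μ 0 {x, y, t} ∧ SpansLcs μ 1 {μ x y} ∧ SpansLcs μ 2 {μ x (μ x y)} ∧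
      μ x t ∈ lcs μ 2 ∧ μ y t ∈ lcs μ 2 ∧ μ y (μ x y) ∈ lcs μ 3 ∧ μ t (μ x y) ∈ lcs μ 3 := by
  have hμ := hT.1
  have ne_bot {n : ℕ} (hn : n ≤ 3) : lcs μ n ≠ ⊥ := ne_bot_of_le_ne_bot h₃ (antitone_lcs μ hn)
  obtain ⟨x, y, t, hg, hz, hxt, hyt⟩ :=
    exists_adapted_generators hμ hN hV (ne_bot (by lia)) hfin₁
  have htz := mul_mem_lcs_three_of_adapted hT hN hg hxt hyt h₃ hfin₂
  have hxy : ¬ (μ x (μ x y) ∈ lcs μ 3 ∧ μ y (μ x y) ∈ lcs μ 3) := fun ⟨hxz, hyz⟩ => by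
    have h₂ := hg.succ hz fun a ha b hb => hT.mul_mem_lcs_three ha hb
    refine ne_bot (by lia) (hN.lcs_eq_bot_of_le (h₂.lcs_le ?_ le_rfl))
    rintro _ ⟨_, rfl | rfl | rfl, _, rfl, rfl⟩ <;> assumption
  obtain ⟨x', y', hspan, hz', hw, hyw⟩ := hz.exists_span_pair_eq hμ hfin₂ hxy
  have hg' : SpansLcs μ 0 {x', y', t} := hg.zero_of_span_le <| by
    simp only [Submodule.span_insert, ← sup_assoc] at hspan ⊢
    rw [hspan]
  have hle : Submodule.span ℂ {x', y'} ≤ (lcs μ 2).comap (μ.flip t) := by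
    rw [hspan, Submodule.span_le]
    exact Set.pair_subset hxt hyt
  have hxt' : μ x' t ∈ lcs μ 2 := hle (Submodule.subset_span (by simp))
  have hyt' : μ y' t ∈ lcs μ 2 := hle (Submodule.subset_span (by simp))
  exact ⟨x', y', t, hg', hz', hw, hxt', hyt', hyw,
    mul_mem_lcs_three_of_adapted hT hN hg' hxt' hyt' h₃ hfin₂⟩

end ThreeGenerators

section ThreeGenerators

variable {V : Type*} [AddCommGroup V] [Module ℂ V] {μ : Product V} {x y t u : V}

theorem exists_isomorphic_threeGen (hT : IsTortkara μ)
    (hV : Module.finrank ℂ V = 6) (hg : SpansLcs μ 0 {x, y, t}) (hz : SpansLcs μ 1 {μ x y})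
    (hw : SpansLcs μ 2 {μ x (μ x y)}) (hu : SpansLcs μ 3 {u}) (h₄ : lcs μ 4 = ⊥)
    (hxt : μ x t ∈ lcs μ 2) (hyt : μ y t ∈ lcs μ 2) (hyz : μ y (μ x y) ∈ lcs μ 3)
    (htz : μ t (μ x y) ∈ lcs μ 3) :
    ∃ p q a b c d k l m, Isomorphic μ (threeGen p q a b c d k l m) := by
  have eq_zero {v : V} (hv : v ∈ lcs μ 4) : v = 0 := by rwa [h₄, Submodule.mem_bot] at hv
  obtain ⟨a, b, hab⟩ := hw.exists_eq_smul_add_smul hu h₄ hxt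
  obtain ⟨c, d, hcd⟩ := hw.exists_eq_smul_add_smul hu h₄ hyt
  obtain ⟨p, hp⟩ := hu.exists_eq_smul h₄ hyz
  obtain ⟨q, hq⟩ := hu.exists_eq_smul h₄ htz
  obtain ⟨k, hk⟩ := hu.exists_eq_smul h₄ (mul_mem_lcs x hw.mem)
  obtain ⟨l, hl⟩ := hu.exists_eq_smul h₄ (mul_mem_lcs y hw.mem)
  obtain ⟨m, hm⟩ := hu.exists_eq_smul h₄ (mul_mem_lcs t hw.mem)
  have hzw : μ (μ x y) (μ x (μ x y)) = 0 := eq_zero (hT.mul_mem_lcs_four hz.mem hw.mem)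
  have mul_u (v : V) : μ v u = 0 := eq_zero (mul_mem_lcs v hu.mem)
  have hzt : μ (μ x y) t = -(q • u) := by rw [hT.1, hq]
  have hwt : μ (μ x (μ x y)) t = -(m • u) := by rw [hT.1, hm]
  let f : Fin 6 → V := ![x, y, μ x y, μ x (μ x y), t, u]
  have mem (i : Fin 6) : f i ∈ Submodule.span ℂ (Set.range f) := Submodule.subset_span ⟨i, rfl⟩
  refine ⟨p, q, a, b, c, d, k, l, m, isomorphic_of_span_eq_top (f := f) hT.1
    (isAnticommutative_ofTable _) (eq_top_iff.mpr ?_) (by simpa) fun i j hij => ?_⟩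
  · refine hg.lcs_le (Set.insert_subset (mem 0) (Set.pair_subset (mem 1) (mem 4))) ?_
    refine hz.lcs_le (Set.singleton_subset_iff.mpr (mem 2)) ?_
    refine hw.lcs_le (Set.singleton_subset_iff.mpr (mem 3)) ?_
    exact hu.lcs_le (Set.singleton_subset_iff.mpr (mem 5)) (h₄.le.trans bot_le)
  · fin_cases i <;> fin_cases j <;> first
    | exact absurd hij (by decide)
    | simp [f, threeGen, ofTable, elementary, e, Fintype.linearCombination_apply_single, hab, hcd,
        hp, hk, hl, hzt, hwt, hzw, mul_u]

theorem isListed_of_finrank_lcs_one_le_three [FiniteDimensional ℂ V] (hT : IsTortkara μ)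
    (hN : IsNilpotent μ) (hM : ¬ IsMalcev μ) (hV : Module.finrank ℂ V = 6)
    (h : Module.finrank ℂ (lcs μ 1) ≤ 3) : IsListed μ := by
  have h₃ := hT.lcs_three_ne_bot hM
  have h₂ := ne_bot_of_le_ne_bot h₃ (antitone_lcs μ (Nat.le_succ 2))
  have h₁ := ne_bot_of_le_ne_bot h₂ (antitone_lcs μ (Nat.le_succ 1))
  have hlt₁ := hN.finrank_lcs_succ_lt h₁
  have hlt₂ := hN.finrank_lcs_succ_lt h₂
  have hlt₃ := hN.finrank_lcs_succ_lt h₃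
  have h₄ : lcs μ 4 = ⊥ := Submodule.finrank_eq_zero.mp (by lia)
  obtain ⟨u, hu, hu₀⟩ := (Submodule.ne_bot_iff _).mp h₃
  have hu' := spansLcs_singleton_of_ne_zero hu hu₀ h₄ (by lia)
  obtain ⟨x, y, t, hg, hz, hw, hxt, hyt, hyz, htz⟩ :=
    exists_three_generators hT hN (by lia) h₃ (by lia) (by lia)
  obtain ⟨p, q, a, b, c, d, k, l, m, hiso⟩ :=
    exists_isomorphic_threeGen hT hV hg hz hw hu' h₄ hxt hyt hyz htz
  exact hiso.isListed (isListed_threeGen _ _ _ _ _ _ _ _ _ fun h => hM (hiso.isMalcev h))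

end ThreeGenerators

section TwoGenerators

variable {V : Type*} [AddCommGroup V] [Module ℂ V] {μ : Product V} {x y : V}

theorem IsTortkara.jacobian_mem_lcs_four (hT : IsTortkara μ) (a b : V) {c : V}
    (hc : c ∈ lcs μ 2) : jacobian μ a b c ∈ lcs μ 4 :=
  add_mem (add_mem (hT.mul_mem_lcs_four (mul_mem_lcs_one _ _) hc)
    (hT.1.mul_mem_lcs (mul_mem_lcs _ hc) _)) (hT.1.mul_mem_lcs (hT.1.mul_mem_lcs hc _) _)

theorem jacobian_mul_self (hμ : IsAnticommutative μ) (x y : V) :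
    jacobian μ x y (μ x y) = μ y (μ x (μ x y)) - μ x (μ y (μ x y)) := by
  rw [jacobian, hμ.mul_self, hμ (μ y (μ x y)) x, hμ (μ x y) x, map_neg, LinearMap.neg_apply,
    hμ (μ x (μ x y)) y]
  abel

theorem SpansLcs.one_of_pair (hg : SpansLcs μ 0 {x, y}) (hμ : IsAnticommutative μ) :
    SpansLcs μ 1 {μ x y} := by
  refine ⟨Set.singleton_subset_iff.mpr (mul_mem_lcs_one x y), ?_⟩
  refine (hg.succ hg fun a ha b _ => hμ.mul_mem_lcs ha b).lcs_le ?_ le_sup_right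
  have mem : μ x y ∈ Submodule.span ℂ {μ x y} ⊔ lcs μ 2 :=
    Submodule.mem_sup_left (Submodule.mem_span_singleton_self _)
  rintro _ ⟨a, rfl | rfl, b, rfl | rfl, rfl⟩
  · simp [hμ.mul_self]
  · exact mem
  · simpa [hμ a] using mem
  · simp [hμ.mul_self]

theorem SpansLcs.succ_pair {n : ℕ} {w : V} (hg : SpansLcs μ 0 {x, y}) (hw : SpansLcs μ n {w})
    (h : ∀ a ∈ lcs μ 1, ∀ b ∈ lcs μ n, μ a b ∈ lcs μ (n + 2)) :
    SpansLcs μ (n + 1) {μ x w, μ y w} := by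
  simpa only [Set.image2_singleton_right, Set.image_pair] using hg.succ hw h

theorem mul_mul_mem_lcs_five (hT : IsTortkara μ) (hg : SpansLcs μ 0 {x, y}) {q : V}
    (hq : q ∈ lcs μ 3) : μ (μ x y) q ∈ lcs μ 5 := by
  refine hg.lcs_succ_le (S := (lcs μ 5).comap (μ (μ x y))) ?_ ?_ hq
  · rintro a (rfl | rfl) b hb <;> rw [Submodule.mem_comap]
    · rw [hT.mul_mul_mul]
      exact neg_mem (hT.1.mul_mem_lcs (hT.jacobian_mem_lcs_four _ _ hb) _)
    · rw [hT.1 a, map_neg, hT.2]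
      exact neg_mem (hT.1.mul_mem_lcs (hT.jacobian_mem_lcs_four _ _ hb) _)
  · exact fun a ha b hb => mul_mem_lcs _ (hT.mul_mem_lcs_four ha hb)

theorem mul_mul_mul_mem_lcs_five (hT : IsTortkara μ) (hg : SpansLcs μ 0 {x, y})
    (hyz : μ y (μ x y) ∈ lcs μ 3) (h₃ : ∀ a ∈ lcs μ 3, ∀ b ∈ lcs μ 3, μ a b ∈ lcs μ 5) {q : V}
    (hq : q ∈ lcs μ 3) : μ (μ x (μ x y)) q ∈ lcs μ 5 := by
  have hμ := hT.1
  have jacobian_mul_mem (a : V) {b : V} (c : V) (hb : b ∈ lcs μ 2) :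
      μ (jacobian μ (μ x y) a b) c ∈ lcs μ 5 :=
    hμ.mul_mem_lcs (hT.jacobian_mem_lcs_four _ _ hb) _
  have hzy : μ (μ x y) y ∈ lcs μ 3 := by rw [hμ]; exact neg_mem hyz
  refine hg.lcs_succ_le (S := (lcs μ 5).comap (μ (μ x (μ x y)))) ?_ ?_ hq
  · simp only [Set.mem_insert_iff, Set.mem_singleton_iff, forall_eq_or_imp, forall_eq,
      Submodule.mem_comap]
    refine ⟨fun b hb => ?_, fun b hb => ?_⟩
    · rw [hT.mul_mul_mul]
      exact neg_mem (hμ.mul_mem_lcs (hT.jacobian_mem_lcs_four _ _ hb) _)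
    · rw [hμ x (μ x y), hμ y b, map_neg, map_neg, LinearMap.neg_apply, neg_neg,
        eq_sub_of_add_eq (hT.linearized (μ x y) x y b)]
      exact sub_mem (add_mem (jacobian_mul_mem _ _ hb) (jacobian_mul_mem _ _ hb))
        (h₃ _ hzy _ (hμ.mul_mem_lcs hb x))
  · exact fun a ha b hb => mul_mem_lcs _ (hT.mul_mem_lcs_four ha hb)

theorem mul_mul_mul_sub_mem_lcs_five (hT : IsTortkara μ) (hyz : μ y (μ x y) ∈ lcs μ 3) :
    μ (μ x y) (μ x (μ x y)) - μ x (μ y (μ x (μ x y))) ∈ lcs μ 5 := by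
  rw [hT.mul_mul_mul, jacobian_mul_self hT.1, ← hT.1 x, map_sub, sub_sub_cancel_left]
  exact neg_mem (mul_mem_lcs x (mul_mem_lcs x hyz))

theorem mul_mul_mul_mul_mem_lcs_five (hT : IsTortkara μ) (hg : SpansLcs μ 0 {x, y})
    (hyz : μ y (μ x y) ∈ lcs μ 3) : μ y (μ y (μ x (μ x y))) ∈ lcs μ 5 := by
  have h := hT.2 x y (μ x y)
  rw [jacobian_mul_self hT.1, hT.1 (μ x y) y, map_neg, hT.1 (_ - _) y, neg_inj, map_sub] at h
  rw [eq_add_of_sub_eq h.symm]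
  exact add_mem (mul_mul_mem_lcs_five hT hg hyz) (mul_mem_lcs y (mul_mem_lcs x hyz))

theorem mul_mem_lcs_five {s : V} (hT : IsTortkara μ) (hg : SpansLcs μ 0 {x, y})
    (hw : SpansLcs μ 2 {μ x (μ x y)}) (hs : SpansLcs μ 3 {s}) (hyz : μ y (μ x y) ∈ lcs μ 3)
    {a b : V} (ha : a ∈ lcs μ 1) (hb : b ∈ lcs μ 3) : μ a b ∈ lcs μ 5 := by
  have h₃ : ∀ a ∈ lcs μ 3, ∀ b ∈ lcs μ 3, μ a b ∈ lcs μ 5 :=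
    fun _ ha _ hb => hs.mul_mem_lcs_add_two hT.1 ha hb
  have h₂ : lcs μ 2 ≤ (lcs μ 5).comap (μ.flip b) := hw.lcs_le
    (Set.singleton_subset_iff.mpr (mul_mul_mul_mem_lcs_five hT hg hyz h₃ hb))
    (fun c hc => h₃ c hc b hb)
  exact (hg.one_of_pair hT.1).lcs_le
    (Set.singleton_subset_iff.mpr (mul_mul_mem_lcs_five hT hg hb)) h₂ ha

theorem exists_isomorphic_form (hT : IsTortkara μ) (hV : Module.finrank ℂ V = 6)
    (hg : SpansLcs μ 0 {x, y}) {u : V} (hu : SpansLcs μ 3 {u}) (h₄ : lcs μ 4 = ⊥) :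
    ∃ M, Isomorphic μ (form M) := by
  have eq_zero {v : V} (hv : v ∈ lcs μ 4) : v = 0 := by rwa [h₄, Submodule.mem_bot] at hv
  have mul_u (v : V) : μ v u = 0 := eq_zero (mul_mem_lcs v hu.mem)
  have hz := hg.one_of_pair hT.1
  have hvw := hg.succ_pair hz fun a ha b hb => hT.mul_mem_lcs_three ha hb
  set z := μ x y with hz_def
  have hv : μ x z ∈ lcs μ 2 := mul_mem_lcs x hz.mem
  have hw : μ y z ∈ lcs μ 2 := mul_mem_lcs y hz.mem
  obtain ⟨a, ha⟩ := hu.exists_eq_smul h₄ (mul_mem_lcs x hv)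
  obtain ⟨b, hb⟩ := hu.exists_eq_smul h₄ (mul_mem_lcs x hw)
  obtain ⟨c, hc⟩ := hu.exists_eq_smul h₄ (mul_mem_lcs y hv)
  obtain ⟨d, hd⟩ := hu.exists_eq_smul h₄ (mul_mem_lcs y hw)
  have hzv : μ z (μ x z) = 0 := eq_zero (hT.mul_mem_lcs_four hz.mem hv)
  have hzw : μ z (μ y z) = 0 := eq_zero (hT.mul_mem_lcs_four hz.mem hw)
  have hvw' : μ (μ x z) (μ y z) = 0 := eq_zero (hT.mul_mem_lcs_four (mul_mem_lcs_one _ _) hw)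
  let f : Fin 6 → V := ![x, y, z, μ x z, μ y z, u]
  have mem (i : Fin 6) : f i ∈ Submodule.span ℂ (Set.range f) := Submodule.subset_span ⟨i, rfl⟩
  refine ⟨!![a, b; c, d], isomorphic_of_span_eq_top (f := f) hT.1
    (isAnticommutative_ofTable _) (eq_top_iff.mpr ?_) (by simpa) fun i j hij => ?_⟩
  · refine hg.lcs_le (Set.pair_subset (mem 0) (mem 1)) ?_
    refine hz.lcs_le (Set.singleton_subset_iff.mpr (mem 2)) ?_
    refine hvw.lcs_le (Set.pair_subset (mem 3) (mem 4)) ?_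
    exact hu.lcs_le (Set.singleton_subset_iff.mpr (mem 5)) (h₄.le.trans bot_le)
  · fin_cases i <;> fin_cases j <;> first
    | exact absurd hij (by decide)
    | simp [f, form, ofTable, elementary, e, Fintype.linearCombination_apply_single, ha, hb,
        hc, hd, hzv, hzw, hvw', mul_u, ← hz_def]

theorem exists_isomorphic_plane (hT : IsTortkara μ) (hV : Module.finrank ℂ V = 6)
    (hg : SpansLcs μ 0 {x, y}) (hw : SpansLcs μ 2 {μ x (μ x y)}) (hyz : μ y (μ x y) ∈ lcs μ 3)
    (h₄ : lcs μ 4 = ⊥) : ∃ a b, Isomorphic μ (plane a b) := by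
  have eq_zero {v : V} (hv : v ∈ lcs μ 4) : v = 0 := by rwa [h₄, Submodule.mem_bot] at hv
  have hz := hg.one_of_pair hT.1
  have hsr := hg.succ_pair hw fun a ha b hb => hT.mul_mem_lcs_four ha hb
  set w := μ x (μ x y) with hw_def
  have mul_three {q : V} (hq : q ∈ lcs μ 3) (v : V) : μ v q = 0 := eq_zero (mul_mem_lcs v hq)
  have hs := mul_three (mul_mem_lcs x hw.mem)
  have hr := mul_three (mul_mem_lcs y hw.mem)
  have hzw : μ (μ x y) w = 0 := eq_zero (hT.mul_mem_lcs_four hz.mem hw.mem)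
  obtain ⟨a, b, hab⟩ : ∃ a b : ℂ, μ y (μ x y) = a • μ x w + b • μ y w := by
    have h := hsr.le_sup hyz
    rw [h₄, sup_bot_eq, Submodule.mem_span_pair] at h
    simpa only [eq_comm] using h
  let f : Fin 6 → V := ![x, y, μ x y, w, μ x w, μ y w]
  have mem (i : Fin 6) : f i ∈ Submodule.span ℂ (Set.range f) := Submodule.subset_span ⟨i, rfl⟩
  refine ⟨a, b, isomorphic_of_span_eq_top (f := f) hT.1
    (isAnticommutative_ofTable _) (eq_top_iff.mpr ?_) (by simpa) fun i j hij => ?_⟩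
  · refine hg.lcs_le (Set.pair_subset (mem 0) (mem 1)) ?_
    refine hz.lcs_le (Set.singleton_subset_iff.mpr (mem 2)) ?_
    refine hw.lcs_le (Set.singleton_subset_iff.mpr (mem 3)) ?_
    exact hsr.lcs_le (Set.pair_subset (mem 4) (mem 5)) (h₄.le.trans bot_le)
  · fin_cases i <;> fin_cases j <;> first
    | exact absurd hij (by decide)
    | simp [f, plane, ofTable, elementary, e, Fintype.linearCombination_apply_single, hab,
        hs, hr, hzw, ← hw_def]

theorem exists_isomorphic_chain (hT : IsTortkara μ) (hN : IsNilpotent μ)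
    (hV : Module.finrank ℂ V = 6) (hg : SpansLcs μ 0 {x, y}) (hw : SpansLcs μ 2 {μ x (μ x y)})
    (hs : SpansLcs μ 3 {μ x (μ x (μ x y))}) {v : V} (hv : SpansLcs μ 4 {v})
    (hyz : μ y (μ x y) ∈ lcs μ 3) (hyw : μ y (μ x (μ x y)) ∈ lcs μ 4) (h₄ : lcs μ 4 ≠ ⊥)
    (h₅ : lcs μ 5 = ⊥) : ∃ a b l n m, (n ≠ 0 ∨ m ≠ 0) ∧ Isomorphic μ (chain a b l n m) := by
  have eq_zero {v : V} (hv : v ∈ lcs μ 5) : v = 0 := by rwa [h₅, Submodule.mem_bot] at hv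
  have mul_four {q : V} (hq : q ∈ lcs μ 4) (a : V) : μ a q = 0 := eq_zero (mul_mem_lcs a hq)
  have hz := hg.one_of_pair hT.1
  have hzw : μ (μ x y) (μ x (μ x y)) = 0 := by
    rw [sub_eq_zero.mp (eq_zero (mul_mul_mul_sub_mem_lcs_five hT hyz)), mul_four hyw]
  have hmul : ∀ a ∈ lcs μ 1, ∀ b ∈ lcs μ 3, μ a b ∈ lcs μ 5 :=
    fun _ ha _ hb => mul_mem_lcs_five hT hg hw hs hyz ha hb
  have hzs := eq_zero (hmul _ hz.mem _ hs.mem)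
  have hws := eq_zero (hmul (μ x (μ x y)) (mul_mem_lcs_one _ _) _ hs.mem)
  obtain ⟨a, b, hab⟩ := hs.exists_eq_smul_add_smul hv h₅ hyz
  obtain ⟨l, hl⟩ := hv.exists_eq_smul h₅ hyw
  obtain ⟨n, hn⟩ := hv.exists_eq_smul h₅ (mul_mem_lcs x hs.mem)
  obtain ⟨m, hm⟩ := hv.exists_eq_smul h₅ (mul_mem_lcs y hs.mem)
  have hnm : n ≠ 0 ∨ m ≠ 0 := by
    by_contra! h
    refine h₄ (hN.lcs_eq_bot_of_le ((hg.succ_pair hs hmul).lcs_le ?_ le_rfl))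
    simp [hn, hm, h]
  let f : Fin 6 → V := ![x, y, μ x y, μ x (μ x y), μ x (μ x (μ x y)), v]
  have mem (i : Fin 6) : f i ∈ Submodule.span ℂ (Set.range f) := Submodule.subset_span ⟨i, rfl⟩
  refine ⟨a, b, l, n, m, hnm, isomorphic_of_span_eq_top (f := f) hT.1
    (isAnticommutative_ofTable _) (eq_top_iff.mpr ?_) (by simpa) fun i j hij => ?_⟩
  · refine hg.lcs_le (Set.pair_subset (mem 0) (mem 1)) ?_
    refine hz.lcs_le (Set.singleton_subset_iff.mpr (mem 2)) ?_
    refine hw.lcs_le (Set.singleton_subset_iff.mpr (mem 3)) ?_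
    refine hs.lcs_le (Set.singleton_subset_iff.mpr (mem 4)) ?_
    exact hv.lcs_le (Set.singleton_subset_iff.mpr (mem 5)) (h₅.le.trans bot_le)
  · fin_cases i <;> fin_cases j <;> first
    | exact absurd hij (by decide)
    | simp [f, chain, ofTable, elementary, e, Fintype.linearCombination_apply_single, hab,
        hl, hn, hm, hzw, hzs, hws, mul_four hv.mem]

theorem exists_isomorphic_twisted (hT : IsTortkara μ)
    (hV : Module.finrank ℂ V = 6) (hg : SpansLcs μ 0 {x, y}) (hw : SpansLcs μ 2 {μ x (μ x y)})
    (hs : SpansLcs μ 3 {μ y (μ x (μ x y))}) (hyz : μ y (μ x y) ∈ lcs μ 3)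
    (h₅ : lcs μ 5 = ⊥) : ∃ a b k l, Isomorphic μ (twisted a b k l) := by
  have eq_zero {v : V} (hv : v ∈ lcs μ 5) : v = 0 := by rwa [h₅, Submodule.mem_bot] at hv
  have mul_four {q : V} (hq : q ∈ lcs μ 4) (a : V) : μ a q = 0 := eq_zero (mul_mem_lcs a hq)
  have hz := hg.one_of_pair hT.1
  have hzw := sub_eq_zero.mp (eq_zero (mul_mul_mul_sub_mem_lcs_five hT hyz))
  have hys := eq_zero (mul_mul_mul_mul_mem_lcs_five hT hg hyz)
  have hmul : ∀ a ∈ lcs μ 1, ∀ b ∈ lcs μ 3, μ a b ∈ lcs μ 5 :=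
    fun _ ha _ hb => mul_mem_lcs_five hT hg hw hs hyz ha hb
  have hzs := eq_zero (hmul _ hz.mem _ hs.mem)
  have hws := eq_zero (hmul (μ x (μ x y)) (mul_mem_lcs_one _ _) _ hs.mem)
  have hv : SpansLcs μ 4 {μ x (μ y (μ x (μ x y)))} := by
    have h := hg.succ_pair hs hmul
    rw [hys] at h
    exact ⟨fun _ h' => h.subset (Or.inl h'), by simpa [Submodule.span_insert] using h.le_sup⟩
  obtain ⟨a, b, hab⟩ := hs.exists_eq_smul_add_smul hv h₅ hyz
  obtain ⟨k, l, hkl⟩ := hs.exists_eq_smul_add_smul hv h₅ (mul_mem_lcs x hw.mem)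
  have hxv := mul_four hv.mem
  set s := μ y (μ x (μ x y)) with hs_def
  let f : Fin 6 → V := ![x, y, μ x y, μ x (μ x y), s, μ x s]
  have mem (i : Fin 6) : f i ∈ Submodule.span ℂ (Set.range f) := Submodule.subset_span ⟨i, rfl⟩
  refine ⟨a, b, k, l, isomorphic_of_span_eq_top (f := f) hT.1
    (isAnticommutative_ofTable _) (eq_top_iff.mpr ?_) (by simpa) fun i j hij => ?_⟩
  · refine hg.lcs_le (Set.pair_subset (mem 0) (mem 1)) ?_
    refine hz.lcs_le (Set.singleton_subset_iff.mpr (mem 2)) ?_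
    refine hw.lcs_le (Set.singleton_subset_iff.mpr (mem 3)) ?_
    refine hs.lcs_le (Set.singleton_subset_iff.mpr (mem 4)) ?_
    exact hv.lcs_le (Set.singleton_subset_iff.mpr (mem 5)) (h₅.le.trans bot_le)
  · fin_cases i <;> fin_cases j <;> first
    | exact absurd hij (by decide)
    | simp [f, twisted, ofTable, elementary, e, Fintype.linearCombination_apply_single, hab,
        hkl, hzw, hzs, hws, hys, hxv, ← hs_def]

end TwoGenerators

/-! ### Pairwise non-isomorphism -/

section Colon

variable {V W : Type*} [AddCommGroup V] [Module ℂ V] [AddCommGroup W] [Module ℂ W]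
  {μ : Product V} {ν : Product W}

/-- The colon subspace `(S : T)` of the vectors that multiply `S` into `T`. -/
def colon (μ : Product V) (S T : Submodule ℂ V) : Submodule ℂ V where
  carrier := {v | ∀ a ∈ S, μ v a ∈ T}
  zero_mem' a _ := by simp
  add_mem' hv hw a ha := by simpa using T.add_mem (hv a ha) (hw a ha)
  smul_mem' r v hv a ha := by simpa using T.smul_mem r (hv a ha)

/-- Formal iterated colons of the whole space and the zero subspace. -/
inductive ColonExpr
  | top
  | bot
  | colon (S T : ColonExpr)

/-- The characteristic subspace of an algebra that a formal iterated colon stands for. -/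
def ColonExpr.subspace (μ : Product V) : ColonExpr → Submodule ℂ V
  | top => ⊤
  | bot => ⊥
  | colon S T => Tortkara.colon μ (S.subspace μ) (T.subspace μ)

theorem ColonExpr.map_subspace {φ : V ≃ₗ[ℂ] W} (hφ : ∀ a b, φ (μ a b) = ν (φ a) (φ b))
    (S : ColonExpr) : (S.subspace μ).map φ.toLinearMap = S.subspace ν := by
  induction S with
  | top => simp [subspace]
  | bot => simp [subspace]
  | colon S T ihS ihT =>
    ext w
    obtain ⟨v, rfl⟩ := φ.surjective w
    have hφ' (a : V) : φ.symm (ν (φ v) (φ a)) = μ v a := by rw [← hφ, φ.symm_apply_apply]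
    simp [subspace, ← ihS, ← ihT, Tortkara.colon, Submodule.mem_map_equiv,
      φ.surjective.forall, hφ']

theorem Isomorphic.finrank_subspace_eq (h : Isomorphic μ ν) (S : ColonExpr) :
    Module.finrank ℂ (S.subspace μ) = Module.finrank ℂ (S.subspace ν) := by
  obtain ⟨φ, hφ⟩ := h
  rw [← S.map_subspace hφ, LinearEquiv.finrank_map_eq]

end Colon

section Support

variable {μ : Product (Fin 6 → ℂ)} {s : List (Fin 6 × Fin 6 × Fin 6)}

/-- The span of the basis vectors with index in the set with indicator function `S`. -/
def coordinate (S : Fin 6 → Bool) : Submodule ℂ (Fin 6 → ℂ) :=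
  ⨅ i ∈ ({i | S i} : Set (Fin 6))ᶜ, LinearMap.ker (LinearMap.proj i)

theorem mem_coordinate {S : Fin 6 → Bool} {v : Fin 6 → ℂ} :
    v ∈ coordinate S ↔ ∀ i, S i = false → v i = 0 := by
  simp [coordinate, Submodule.mem_iInf]

theorem finrank_coordinate (S : Fin 6 → Bool) :
    Module.finrank ℂ (coordinate S) = (List.finRange 6).countP S := by
  have h := LinearMap.iInfKerProjEquiv ℂ (fun _ : Fin 6 => ℂ) (I := {i | S i}) (J := {i | S i}ᶜ)
    disjoint_compl_right (by simp)
  rw [coordinate, h.finrank_eq, Module.finrank_fintype_fun_eq_card, Fintype.card_subtype]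
  simp [Finset.card, Finset.filter, Finset.univ, Fintype.elems, List.countP_eq_length_filter]

theorem mem_colon_coordinate {S T : Fin 6 → Bool} {v : Fin 6 → ℂ} :
    v ∈ colon μ (coordinate S) (coordinate T) ↔
      ∀ j, S j = true → ∀ k, T k = false → μ v (e j) k = 0 := by
  refine ⟨fun h j hj => mem_coordinate.mp (h _ (mem_coordinate.mpr fun i hi => ?_)), fun h a ha =>
    mem_coordinate.mpr fun k hk => ?_⟩
  · exact Pi.single_eq_of_ne (by rintro rfl; simp_all) 1
  · rw [pi_eq_sum_univ' a, map_sum, Finset.sum_apply]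
    refine Finset.sum_eq_zero fun j _ => ?_
    cases hj : S j
    · simp [mem_coordinate.mp ha j hj]
    · simpa [e] using Or.inr (h j hj k hk)

/-- The nonzero structure constants of the product `μ` are those with indices in `s`: the product
`(e i)(e j)` has a nonzero coordinate `k` exactly if `(i, j, k)` belongs to `s`. -/
def HasSupport (μ : Product (Fin 6 → ℂ)) (s : List (Fin 6 × Fin 6 × Fin 6)) : Prop :=
  ∀ i j k, μ (e i) (e j) k ≠ 0 ↔ (i, j, k) ∈ s

/-- Indicates the basis vectors that multiply `coordinate S` into `coordinate T`, in an algebra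
with support `s`. -/
def colonIndex (s : List (Fin 6 × Fin 6 × Fin 6)) (S T : Fin 6 → Bool) (i : Fin 6) : Bool :=
  s.all fun t => t.1 != i || !S t.2.1 || T t.2.2

/-- The linear equations of `(coordinate S : coordinate T)` are triangular: the vanishing of every
coordinate outside `colonIndex s S T` follows from one of the equations, by the vanishing of the
preceding ones. -/
def isTriangular (s : List (Fin 6 × Fin 6 × Fin 6)) (S T : Fin 6 → Bool) : Bool :=
  (List.finRange 6).all fun i => colonIndex s S T i || s.any fun t =>
    t.1 == i && S t.2.1 && !T t.2.2 && s.all fun t' => t'.2 != t.2 || decide (t'.1 ≤ i)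

theorem colon_coordinate (hs : HasSupport μ s) {S T : Fin 6 → Bool} (h : isTriangular s S T) :
    colon μ (coordinate S) (coordinate T) = coordinate (colonIndex s S T) := by
  have mul_apply (v : Fin 6 → ℂ) (j k : Fin 6) :
      μ v (e j) k = ∑ i, v i * μ (e i) (e j) k := by
    conv_lhs => rw [pi_eq_sum_univ' v, map_sum, LinearMap.sum_apply, Finset.sum_apply]
    simp [e]
  have not_colonIndex {i j k} (hmem : (i, j, k) ∈ s) (hj : S j = true) (hk : T k = false) :
      colonIndex s S T i = false := by
    simpa [colonIndex] using ⟨_, _, hmem, hj, hk⟩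
  ext v
  rw [mem_colon_coordinate, mem_coordinate]
  refine ⟨fun hv i => ?_, fun hv j hj k hk => ?_⟩
  · induction i using WellFoundedLT.induction with
    | ind i ih =>
    intro hi
    obtain ⟨j, k, ht, ⟨hj, hk⟩, hlast⟩ : ∃ j k, (i, j, k) ∈ s ∧ (S j = true ∧ T k = false) ∧
        ∀ i' j' k', (i', j', k') ∈ s → (j' = j → k' ≠ k) ∨ i' ≤ i := by
      simpa [hi] using List.all_eq_true.mp h i (List.mem_finRange i)
    have hsum := hv j hj k hk
    rw [mul_apply, Finset.sum_eq_single_of_mem i (Finset.mem_univ i)] at hsum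
    · exact (mul_eq_zero.mp hsum).resolve_right ((hs i j k).mpr ht)
    · intro i' _ hne
      by_contra hterm
      obtain ⟨hvi, hmem⟩ := mul_ne_zero_iff.mp hterm
      rw [hs] at hmem
      have hle : i' ≤ i := (hlast i' j k hmem).resolve_left (by simp)
      exact hvi (ih i' (lt_of_le_of_ne hle hne) (not_colonIndex hmem hj hk))
  · rw [mul_apply]
    refine Finset.sum_eq_zero fun i _ => ?_
    by_contra hterm
    obtain ⟨hvi, hmem⟩ := mul_ne_zero_iff.mp hterm
    rw [hs] at hmem
    exact hvi (hv i (not_colonIndex hmem hj hk))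

/-- Indicates the coordinate subspace that an iterated colon stands for, in an algebra with
support `s`. -/
def ColonExpr.index (s : List (Fin 6 × Fin 6 × Fin 6)) : ColonExpr → Fin 6 → Bool
  | top => fun _ => true
  | bot => fun _ => false
  | colon S T => colonIndex s (S.index s) (T.index s)

/-- Whether all the colons taken in an iterated colon are given by triangular equations. -/
def ColonExpr.isTriangular (s : List (Fin 6 × Fin 6 × Fin 6)) : ColonExpr → Bool
  | top | bot => true
  | colon S T => S.isTriangular s && T.isTriangular s &&
      Tortkara.isTriangular s (S.index s) (T.index s)

theorem ColonExpr.subspace_eq_coordinate (hs : HasSupport μ s) {S : ColonExpr}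
    (h : S.isTriangular s) : S.subspace μ = coordinate (S.index s) := by
  induction S with
  | top => ext v; simp [subspace, index, mem_coordinate]
  | bot => ext v; simp [subspace, index, mem_coordinate, funext_iff, -Matrix.zero_empty]
  | colon S T ihS ihT =>
    simp only [isTriangular, Bool.and_eq_true] at h
    rw [subspace, index, ihS h.1.1, ihT h.1.2, colon_coordinate hs h.2]

theorem Isomorphic.countP_index_eq {ν : Product (Fin 6 → ℂ)} {s' : List (Fin 6 × Fin 6 × Fin 6)}
    (h : Isomorphic μ ν) (hs : HasSupport μ s) (hs' : HasSupport ν s') {S : ColonExpr}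
    (hS : S.isTriangular s) (hS' : S.isTriangular s') :
    (List.finRange 6).countP (S.index s) = (List.finRange 6).countP (S.index s') := by
  rw [← finrank_coordinate, ← finrank_coordinate, ← S.subspace_eq_coordinate hs hS,
    ← S.subspace_eq_coordinate hs' hS', h.finrank_subspace_eq]

theorem hasSupport_ofTable_nil : HasSupport (ofTable []) [] := by
  simp [HasSupport, ofTable]

theorem HasSupport.ofTable_cons {L : List (Fin 6 × Fin 6 × (Fin 6 → ℂ))}
    (h : HasSupport (ofTable L) s) {i j k : Fin 6} {v : Fin 6 → ℂ} (hij : i ≠ j)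
    (hv : ∀ l, v l ≠ 0 ↔ l = k) (h₁ : (i, j, k) ∉ s) (h₂ : (j, i, k) ∉ s) :
    HasSupport (ofTable ((i, j, v) :: L)) ((i, j, k) :: (j, i, k) :: s) := by
  intro a b l
  have hL := h a b l
  rw [Tortkara.ofTable_cons, Pi.add_apply, Pi.smul_apply, smul_eq_mul]
  rcases eq_or_ne l k with rfl | hl
  · rcases eq_or_ne (a, b) (i, j) with hab | hab
    · obtain ⟨rfl, rfl⟩ := Prod.ext_iff.mp hab
      simp_all [e]
    rcases eq_or_ne (a, b) (j, i) with hba | hba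
    · obtain ⟨rfl, rfl⟩ := Prod.ext_iff.mp hba
      simp_all [e]
    have hcoeff : e a i * e b j - e a j * e b i = 0 := by
      simp only [e, Pi.single_apply]
      grind
    have hmem : (a, b, l) ∈ (i, j, l) :: (j, i, l) :: s ↔ (a, b, l) ∈ s := by grind
    rw [hcoeff, zero_mul, zero_add, hL, hmem]
  · have hvl : v l = 0 := by simpa [hl] using hv l
    simp_all

theorem e_apply_ne_zero (k l : Fin 6) : e k l ≠ 0 ↔ l = k := by
  simp [e, Pi.single_apply]

/-- The index triples, up to anticommutativity, of the nonzero products of basis vectors. The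
algebras `T18 α` are listed in position `18`, except `T18 0`, which is in position `20`. -/
def halfSupport : Fin 21 → List (Fin 6 × Fin 6 × Fin 6) :=
  ![[(0, 1, 2), (0, 2, 3), (1, 3, 4)],
    [(0, 1, 2), (0, 2, 3), (0, 3, 4), (1, 2, 4), (1, 3, 5)],
    [(0, 1, 2), (0, 2, 3), (1, 2, 4), (1, 3, 5)],
    [(0, 1, 2), (0, 2, 3), (0, 3, 4), (1, 3, 5)],
    [(0, 1, 2), (0, 2, 3), (0, 4, 5), (1, 3, 5)],
    [(0, 1, 2), (0, 2, 3), (1, 2, 5), (3, 4, 5)],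
    [(0, 1, 2), (0, 2, 3), (1, 3, 5), (2, 4, 5)],
    [(0, 1, 2), (0, 2, 3), (3, 4, 5)],
    [(0, 1, 2), (0, 2, 3), (0, 3, 5), (0, 4, 5), (1, 2, 4), (1, 3, 5)],
    [(0, 1, 2), (0, 2, 3), (0, 4, 5), (1, 2, 4), (1, 3, 5)],
    [(0, 1, 2), (0, 2, 5), (0, 3, 4), (1, 2, 4), (3, 4, 5)],
    [(0, 1, 2), (0, 3, 4), (0, 4, 5), (1, 2, 4)],
    [(0, 1, 2), (0, 3, 4), (0, 4, 5), (1, 2, 4), (1, 3, 5)],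
    [(0, 1, 2), (0, 3, 4), (0, 4, 5), (1, 2, 4), (2, 3, 5)],
    [(0, 1, 2), (0, 3, 4), (1, 2, 4), (3, 4, 5)],
    [(0, 1, 2), (0, 2, 3), (0, 3, 4), (0, 4, 5), (1, 3, 5)],
    [(0, 1, 2), (0, 2, 3), (0, 3, 4), (1, 4, 5)],
    [(0, 1, 2), (0, 2, 3), (0, 3, 4), (1, 2, 4), (1, 4, 5)],
    [(0, 1, 2), (0, 2, 3), (0, 3, 4), (0, 4, 5), (1, 2, 4), (1, 3, 5)],
    [(0, 1, 2), (0, 2, 3), (0, 4, 5), (1, 3, 4), (2, 3, 5)],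
    [(0, 1, 2), (0, 2, 3), (0, 3, 4), (0, 4, 5), (1, 2, 4)]]

/-- The index triples of all nonzero structure constants of the algebras at position `a`: the
closure of `halfSupport a` under anticommutativity. -/
def support (a : Fin 21) : List (Fin 6 × Fin 6 × Fin 6) :=
  (halfSupport a).flatMap fun t => [t, (t.2.1, t.1, t.2.2)]

open Classical in
/-- The position of the named algebra in `halfSupport`. -/
noncomputable def Name.kind : Name → Fin 21
  | .T00 => 0 | .T01 => 1 | .T02 => 2 | .T03 => 3 | .T04 => 4 | .T05 => 5 | .T06 => 6
  | .T07 => 7 | .T08 => 8 | .T09 _ => 9 | .T10 => 10 | .T11 => 11 | .T12 => 12 | .T13 => 13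
  | .T14 => 14 | .T15 => 15 | .T16 => 16 | .T17 => 17 | .T18 α => if α = 0 then 20 else 18
  | .T19 => 19

theorem hasSupport_ofTable {L : List (Fin 6 × Fin 6 × (Fin 6 → ℂ))}
    (h : List.Forall₂ (fun r t => r.1 = t.1 ∧ r.2.1 = t.2.1 ∧ ∀ l, r.2.2 l ≠ 0 ↔ l = t.2.2) L s)
    (hne : ∀ t ∈ s, t.1 ≠ t.2.1) (hs : (s.flatMap fun t => [t, (t.2.1, t.1, t.2.2)]).Nodup) :
    HasSupport (ofTable L) (s.flatMap fun t => [t, (t.2.1, t.1, t.2.2)]) := by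
  induction h with
  | nil => exact hasSupport_ofTable_nil
  | @cons r t L s hrt _ ih =>
    obtain ⟨i, j, v⟩ := r
    obtain ⟨_, _, k⟩ := t
    obtain ⟨rfl, rfl, hv⟩ := hrt
    simp only [List.flatMap_cons, List.cons_append, List.nil_append, List.nodup_cons] at hs ⊢
    refine (ih (fun t ht => hne t (List.mem_cons_of_mem _ ht)) hs.2.2).ofTable_cons
      (hne _ List.mem_cons_self) hv (fun h => hs.1 (List.mem_cons_of_mem _ h)) hs.2.1

theorem nodup_support (a : Fin 21) : (support a).Nodup := by
  revert a
  decide +kernel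

theorem fst_ne_of_mem_halfSupport (a : Fin 21) : ∀ t ∈ halfSupport a, t.1 ≠ t.2.1 := by
  revert a
  decide +kernel

theorem Name.Nondegenerate.hasSupport {N : Name} (hN : N.Nondegenerate) :
    HasSupport N.product (support N.kind) := by
  suffices ∃ L, N.product = ofTable L ∧ List.Forall₂ (fun r t => r.1 = t.1 ∧ r.2.1 = t.2.1 ∧
      ∀ l, r.2.2 l ≠ 0 ↔ l = t.2.2) L (halfSupport N.kind) by
    obtain ⟨L, hL, h⟩ := this
    exact hL ▸ hasSupport_ofTable h (fst_ne_of_mem_halfSupport _) (nodup_support _)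
  by_cases h : N = .T18 0
  · subst h
    refine ⟨[(0, 1, e 2), (0, 2, e 3), (0, 3, e 4), (0, 4, e 5), (1, 2, e 4)], ?_, ?_⟩
    · refine LinearMap.ext₂ fun x y => ?_
      simp [Name.product_eq_ofTable, Name.table, Tortkara.ofTable_cons]
    · simp [halfSupport, Name.kind, e_apply_ne_zero]
  refine ⟨N.table, N.product_eq_ofTable, ?_⟩
  cases N
  case T18 α =>
    have hα : α ≠ 0 := fun hα => h (hα ▸ rfl)
    have hα' := add_eq_zero_iff_eq_neg.not.mpr hN
    simp [Name.table, halfSupport, Name.kind, hα, e_apply_ne_zero, hα']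
  case T09 α =>
    have hα' := add_eq_zero_iff_eq_neg.not.mpr hN.2
    simp [Name.table, halfSupport, Name.kind, hN.1, e_apply_ne_zero, hα']
  all_goals
    simp [Name.table, halfSupport, Name.kind, e_apply_ne_zero]

/-- A family of iterated colons whose dimensions separate the supports, except that of `T08` from
that of `T09 α` and those of the algebras `T18 α` from each other. -/
def separating : Fin 4 → ColonExpr :=
  let Z₁ : ColonExpr := .colon .top .bot
  let Z₂ := ColonExpr.colon .top Z₁
  let Z₃ := ColonExpr.colon .top Z₂
  ![.colon (.colon Z₂ .bot) Z₁, .colon (.colon Z₃ .bot) .bot, .colon (.colon Z₃ Z₁) .bot,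
    .colon (.colon (.colon Z₂ .bot) Z₂) .bot]

theorem isTriangular_separating (a : Fin 21) (r : Fin 4) :
    (separating r).isTriangular (support a) := by
  revert a r
  decide +kernel

theorem eq_or_of_countP_index_eq (a b : Fin 21)
    (h : ∀ r, (List.finRange 6).countP ((separating r).index (support a)) =
      (List.finRange 6).countP ((separating r).index (support b))) :
    a = b ∨ ((a = 8 ∨ a = 9) ∧ (b = 8 ∨ b = 9)) ∨ ((a = 18 ∨ a = 20) ∧ (b = 18 ∨ b = 20)) := by
  revert a b
  decide +kernel

theorem Isomorphic.eq_or_exists {N N' : Name} (hN : N.Nondegenerate) (hN' : N'.Nondegenerate)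
    (h : Isomorphic N.product N'.product) :
    N = N' ∨ ((N = .T08 ∨ ∃ α, N = .T09 α) ∧ (N' = .T08 ∨ ∃ α, N' = .T09 α)) ∨
      ((∃ α, N = .T18 α) ∧ ∃ α, N' = .T18 α) := by
  have hkind := eq_or_of_countP_index_eq N.kind N'.kind fun r => h.countP_index_eq hN.hasSupport
    hN'.hasSupport (isTriangular_separating _ r) (isTriangular_separating _ r)
  cases N <;> cases N' <;> simp [Name.kind] at hkind ⊢ <;> split_ifs at hkind <;> simp at hkind

end Support

theorem form_apply_apply_apply (M : Matrix (Fin 2) (Fin 2) ℂ) (x y z w : Fin 6 → ℂ) :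
    form M x (form M y (form M z w)) = ((z 0 * w 1 - z 1 * w 0) * (M 0 0 * (x 0 * y 0) +
      M 0 1 * (x 0 * y 1) + M 1 0 * (x 1 * y 0) + M 1 1 * (x 1 * y 1))) • e 5 := by
  simp only [form, ofTable_cons, ofTable_nil, Matrix.cons_val, e_eq_vec, smul_vec, add_vec,
    vec_eq_vec_iff]
  grind

theorem exists_of_isomorphic_form {M M' : Matrix (Fin 2) (Fin 2) ℂ} (hM' : M' ≠ 0)
    (h : Isomorphic (form M) (form M')) :
    ∃ (P : Matrix (Fin 2) (Fin 2) ℂ) (r : ℂ), P.det ≠ 0 ∧ r ≠ 0 ∧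
      r • M' = P.det • (P * M * P.transpose) := by
  obtain ⟨φ, hφ⟩ := h.symm
  set P := !![φ (e 0) 0, φ (e 0) 1; φ (e 1) 0, φ (e 1) 1]
  have hP (i : Fin 2) : φ (![e 0, e 1] i) 0 = P i 0 ∧ φ (![e 0, e 1] i) 1 = P i 1 := by
    revert i
    simp [Fin.forall_fin_two, P]
  have hdet : φ (e 0) 0 * φ (e 1) 1 - φ (e 0) 1 * φ (e 1) 0 = P.det := by
    simp [P, Matrix.det_fin_two]
  have hprod (i j : Fin 2) :
      M' i j • φ (e 5) = (P.det * (P * M * P.transpose) i j) • e 5 := by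
    have hM'ij : form M' (![e 0, e 1] i) (form M' (![e 0, e 1] j) (form M' (e 0) (e 1))) =
        M' i j • e 5 := by
      rw [form_apply_apply_apply]
      congr 1
      revert i j
      simp [Fin.forall_fin_two, e]
    rw [← map_smul, ← hM'ij, hφ, hφ, hφ, form_apply_apply_apply, (hP i).1, (hP i).2, (hP j).1,
      (hP j).2, hdet]
    simp only [Matrix.mul_apply, Fin.sum_univ_two, Matrix.transpose_apply]
    congr 1
    ring
  have hr : φ (e 5) 5 • M' = P.det • (P * M * P.transpose) := by
    ext i j
    simpa [e, mul_comm] using congr_fun (hprod i j) 5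
  have hne : φ (e 5) 5 • M' ≠ 0 := by
    refine fun h₀ => hM' ?_
    ext i j
    have hij := congr_fun₂ (hr.symm.trans h₀) i j
    have h₅ := hprod i j
    rw [← smul_eq_mul, ← Matrix.smul_apply, hij, Matrix.zero_apply, zero_smul] at h₅
    exact (smul_eq_zero.mp h₅).resolve_right (by simp [e])
  exact ⟨P, φ (e 5) 5, fun h₀ => hne (by rw [hr, h₀, zero_smul]),
    fun h₀ => hne (by rw [h₀, zero_smul]), hr⟩

theorem det_mul_sq_eq_of_isomorphic_form {M M' : Matrix (Fin 2) (Fin 2) ℂ} (hM' : M' ≠ 0)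
    (h : Isomorphic (form M) (form M')) :
    M'.det * (M 0 1 - M 1 0) ^ 2 = M.det * (M' 0 1 - M' 1 0) ^ 2 := by
  obtain ⟨P, r, hP, hr, h⟩ := exists_of_isomorphic_form hM' h
  have hdet : r ^ 2 * M'.det = P.det ^ 4 * M.det := by
    have h_det := congrArg Matrix.det h
    simp only [Matrix.det_smul, Matrix.det_mul, Matrix.det_transpose, Fintype.card_fin] at h_det
    linear_combination h_det
  have hskew : r * (M' 0 1 - M' 1 0) = P.det ^ 2 * (M 0 1 - M 1 0) := by
    simp only [← Matrix.ext_iff, Fin.forall_fin_two, Matrix.smul_apply, Matrix.mul_apply,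
      Fin.sum_univ_two, Matrix.transpose_apply, smul_eq_mul, Matrix.det_fin_two] at h ⊢
    linear_combination h.1.2 - h.2.1
  refine mul_left_cancel₀ (pow_ne_zero 2 (mul_ne_zero hr (pow_ne_zero 2 hP))) ?_
  linear_combination P.det ^ 4 * (M 0 1 - M 1 0) ^ 2 * hdet -
    P.det ^ 4 * M.det * (r * (M' 0 1 - M' 1 0) + P.det ^ 2 * (M 0 1 - M 1 0)) * hskew

theorem transpose_eq_neg_of_isomorphic_form {M M' : Matrix (Fin 2) (Fin 2) ℂ} (hM' : M' ≠ 0)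
    (hM : M.transpose = -M) (h : Isomorphic (form M) (form M')) : M'.transpose = -M' := by
  obtain ⟨P, r, -, hr, h⟩ := exists_of_isomorphic_form hM' h
  refine smul_right_injective _ hr ?_
  beta_reduce
  rw [smul_neg, h, ← Matrix.transpose_smul, h, Matrix.transpose_smul]
  simp [Matrix.transpose_mul, hM, Matrix.mul_assoc]

theorem not_isomorphic_T09_T08 (α : ℂ) : ¬ Isomorphic (Name.T09 α).product Name.T08.product := by
  intro h
  rw [Name.product_T08, Name.product_T09] at h
  have hM' : !![1, -1; 1, (0 : ℂ)] ≠ 0 := fun h => by simpa using congr_fun₂ h 0 0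
  have hα := det_mul_sq_eq_of_isomorphic_form hM' h
  have hα' : α = -(1 / 2) := by
    have hsq : (2 * α + 1) ^ 2 = 0 := by
      simp only [Matrix.det_fin_two_of, Matrix.of_apply, Matrix.cons_val] at hα
      linear_combination hα
    linear_combination (pow_eq_zero_iff two_ne_zero).mp hsq / 2
  have hskew := transpose_eq_neg_of_isomorphic_form hM' (by
    rw [hα', transpose_fin_two_of]
    ext i j
    fin_cases i <;> fin_cases j <;> norm_num) h
  have h_entry := congr_fun₂ hskew 0 0
  norm_num at h_entry

theorem eq_or_eq_of_isomorphic_T09 {α β : ℂ}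
    (h : Isomorphic (Name.T09 α).product (Name.T09 β).product) : β = α ∨ β = -α - 1 := by
  rw [Name.product_T09, Name.product_T09] at h
  have hM' : !![0, β + 1; β, 0] ≠ 0 := fun h => by
    have h₁ := congr_fun₂ h 1 0
    have h₂ := congr_fun₂ h 0 1
    simp_all
  have hdet := det_mul_sq_eq_of_isomorphic_form hM' h
  have hfactor : (β - α) * (β - (-α - 1)) = 0 := by
    simp only [Matrix.det_fin_two_of, Matrix.of_apply, Matrix.cons_val] at hdet
    linear_combination -hdet
  simpa [sub_eq_zero] using hfactor

theorem Name.exists_product_T18_apply (α : ℂ) (x y : Fin 6 → ℂ) :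
    ∃ p q r, (Name.T18 α).product x y = ![0, 0, x 0 * y 1 - x 1 * y 0, p, q, r] := by
  simp only [Name.product_eq_ofTable, Name.table, ofTable_cons, ofTable_nil, e_eq_vec, smul_vec,
    add_vec, vec_eq_vec_iff]
  exact ⟨_, _, _, by ring, by ring, by ring, rfl, rfl, rfl⟩

theorem Name.product_T18_apply_vec (α : ℂ) (x : Fin 6 → ℂ) (d p q r : ℂ) :
    (Name.T18 α).product x ![0, 0, d, p, q, r] =
      ![0, 0, 0, x 0 * d, x 0 * p + x 1 * d, (α + 1) * (x 0 * q) + α * (x 1 * p)] := by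
  simp only [Name.product_eq_ofTable, Name.table, ofTable_cons, ofTable_nil, Matrix.cons_val,
    e_eq_vec, smul_vec, add_vec, vec_eq_vec_iff]
  refine ⟨?_, ?_, ?_, ?_, ?_, ?_⟩ <;> ring

theorem Name.product_T18_xxxxy (α : ℂ) (x y : Fin 6 → ℂ) :
    let μ := (Name.T18 α).product
    μ x (μ x (μ x (μ x y))) = ((α + 1) * (x 0 ^ 3 * (x 0 * y 1 - x 1 * y 0))) • e 5 := by
  obtain ⟨p, q, r, hxy⟩ := Name.exists_product_T18_apply α x y
  simp only [hxy, Name.product_T18_apply_vec, e_eq_vec, smul_vec, vec_eq_vec_iff]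
  refine ⟨?_, ?_, ?_, ?_, ?_, ?_⟩ <;> ring

theorem Name.product_T18_yxxxy (α : ℂ) (x y : Fin 6 → ℂ) :
    let μ := (Name.T18 α).product
    μ y (μ x (μ x (μ x y))) = ((α + 1) * (y 0 * x 0 ^ 2 * (x 0 * y 1 - x 1 * y 0))) • e 5 := by
  obtain ⟨p, q, r, hxy⟩ := Name.exists_product_T18_apply α x y
  simp only [hxy, Name.product_T18_apply_vec, e_eq_vec, smul_vec, vec_eq_vec_iff]
  refine ⟨?_, ?_, ?_, ?_, ?_, ?_⟩ <;> ring

theorem Name.product_T18_xyxy (α : ℂ) (x : Fin 6 → ℂ) {y : Fin 6 → ℂ} (hy : y 0 = 0) :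
    let μ := (Name.T18 α).product
    μ x (μ y (μ x y)) = ((α + 1) * (x 0 * y 1) ^ 2) • e 5 := by
  obtain ⟨p, q, r, hxy⟩ := Name.exists_product_T18_apply α x y
  simp only [hxy, Name.product_T18_apply_vec, e_eq_vec, smul_vec, vec_eq_vec_iff, hy]
  refine ⟨?_, ?_, ?_, ?_, ?_, ?_⟩ <;> ring

theorem Name.product_T18_yxxy (α : ℂ) (x : Fin 6 → ℂ) {y : Fin 6 → ℂ} (hy : y 0 = 0) :
    let μ := (Name.T18 α).product
    μ y (μ x (μ x y)) = (α * (x 0 * y 1) ^ 2) • e 5 := by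
  obtain ⟨p, q, r, hxy⟩ := Name.exists_product_T18_apply α x y
  simp only [hxy, Name.product_T18_apply_vec, e_eq_vec, smul_vec, vec_eq_vec_iff, hy]
  refine ⟨?_, ?_, ?_, ?_, ?_, ?_⟩ <;> ring

theorem eq_of_isomorphic_T18 {α β : ℂ} (hα : α ≠ -1)
    (h : Isomorphic (Name.T18 α).product (Name.T18 β).product) : α = β := by
  obtain ⟨φ, hφ⟩ := h
  have he : e 0 0 = 1 ∧ e 0 1 = 0 ∧ e 1 0 = 0 ∧ e 1 1 = 1 := by simp [e]
  have hx := congrArg φ (Name.product_T18_xxxxy α (e 0) (e 1))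
  have hy := congrArg φ (Name.product_T18_yxxxy α (e 0) (e 1))
  have hxy := congrArg φ (Name.product_T18_xyxy α (e 0) he.2.2.1)
  have hyx := congrArg φ (Name.product_T18_yxxy α (e 0) he.2.2.1)
  simp only [hφ] at hx hy hxy hyx
  simp only [Name.product_T18_xxxxy, Name.product_T18_yxxxy, map_smul, he, one_pow, mul_one,
    mul_zero, sub_zero, zero_smul] at hx hy hxy hyx
  have hx₀ := hx.trans_ne (smul_ne_zero (add_eq_zero_iff_eq_neg.not.mpr hα) (by simp [e]))
  simp only [ne_eq, smul_eq_zero, mul_eq_zero, pow_eq_zero_iff three_ne_zero, not_or] at hx₀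
  obtain ⟨⟨hβ, hx₀, hd⟩, he₅⟩ := hx₀
  have hy₀ : φ (e 1) 0 = 0 := by simpa [hβ, hx₀, hd, he₅] using hy
  rw [Name.product_T18_xyxy β _ hy₀] at hxy
  rw [Name.product_T18_yxxy β _ hy₀] at hyx
  have hd' : φ (e 0) 0 * φ (e 1) 1 ≠ 0 := by simpa [hy₀] using hd
  replace hxy := congr_fun hxy 5
  replace hyx := congr_fun hyx 5
  simp only [Pi.smul_apply, smul_eq_mul, show e 5 5 = 1 by simp [e], mul_one] at hxy hyx
  refine mul_right_cancel₀ (pow_ne_zero 2 hd') ?_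
  linear_combination α * (hxy - hyx) - hyx

theorem isomorphic_product_iff {N N' : Name} (hN : N.Nondegenerate) (hN' : N'.Nondegenerate) :
    Isomorphic N.product N'.product ↔ N = N' ∨ ∃ α, N = .T09 α ∧ N' = .T09 (-α - 1) := by
  constructor
  · intro h
    obtain rfl | ⟨rfl | ⟨α, rfl⟩, rfl | ⟨β, rfl⟩⟩ | ⟨⟨α, rfl⟩, β, rfl⟩ := h.eq_or_exists hN hN'
    · exact .inl rfl
    · exact .inl rfl
    · exact absurd h.symm (not_isomorphic_T09_T08 β)
    · exact absurd h (not_isomorphic_T09_T08 α)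
    · obtain rfl | rfl := eq_or_eq_of_isomorphic_T09 h
      · exact .inl rfl
      · exact .inr ⟨α, rfl, rfl⟩
    · exact .inl (congrArg Name.T18 (eq_of_isomorphic_T18 hN h))
  · rintro (rfl | ⟨α, rfl, rfl⟩)
    · exact Isomorphic.refl _
    · exact isomorphic_T09_swap α

section TwoGenerators

variable {V : Type*} [AddCommGroup V] [Module ℂ V] {μ : Product V} {x y : V}

theorem exists_spansLcs_zero_pair [FiniteDimensional ℂ V]
    (h : Module.finrank ℂ V = Module.finrank ℂ (lcs μ 1) + 2) : ∃ x y, SpansLcs μ 0 {x, y} := by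
  obtain ⟨g, hg⟩ := exists_spansLcs_zero μ h
  exact ⟨g 0, g 1, by simpa [Fin.range_fin_succ, Fin.tail] using hg⟩

theorem isListed_of_lcs_five_eq_bot [FiniteDimensional ℂ V] (hT : IsTortkara μ)
    (hN : IsNilpotent μ) (hM : ¬ IsMalcev μ) (hV : Module.finrank ℂ V = 6)
    (hg : SpansLcs μ 0 {x, y}) (hw : SpansLcs μ 2 {μ x (μ x y)}) (hyz : μ y (μ x y) ∈ lcs μ 3)
    (h₄ : lcs μ 4 ≠ ⊥) (h₅ : lcs μ 5 = ⊥) (hfin₃ : Module.finrank ℂ (lcs μ 3) ≤ 2)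
    (hfin₄ : Module.finrank ℂ (lcs μ 4) = 1) : IsListed μ := by
  by_cases hyw : μ y (μ x (μ x y)) ∈ lcs μ 4
  · have hxw : μ x (μ x (μ x y)) ∉ lcs μ 4 := fun hxw => by
      have h₃ := hg.succ_pair hw fun a ha b hb => hT.mul_mem_lcs_four ha hb
      exact ne_bot_of_le_ne_bot h₄ (antitone_lcs μ (Nat.le_succ 3))
        (hN.lcs_eq_bot_of_le (h₃.lcs_le (Set.pair_subset hxw hyw) le_rfl))
    have hs := spansLcs_singleton (mul_mem_lcs x hw.mem) hxw (by lia)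
    obtain ⟨v, hv, hv₀⟩ := (Submodule.ne_bot_iff _).mp h₄
    obtain ⟨a, b, l, n, m, hnm, hiso⟩ := exists_isomorphic_chain hT hN hV hg hw hs
      (spansLcs_singleton_of_ne_zero hv hv₀ h₅ hfin₄.le) hyz hyw h₄ h₅
    exact hiso.isListed (isListed_chain hnm fun h => hM (hiso.isMalcev h))
  · obtain ⟨a, b, k, l, hiso⟩ := exists_isomorphic_twisted hT hV hg hw
      (spansLcs_singleton (mul_mem_lcs y hw.mem) hyw (by lia)) hyz h₅
    exact hiso.isListed (isListed_twisted a b k l)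

theorem isListed_of_finrank_lcs_one_eq_four [FiniteDimensional ℂ V] (hT : IsTortkara μ)
    (hN : IsNilpotent μ) (hM : ¬ IsMalcev μ) (hV : Module.finrank ℂ V = 6)
    (hfin₁ : Module.finrank ℂ (lcs μ 1) = 4) : IsListed μ := by
  obtain ⟨x, y, hg⟩ := exists_spansLcs_zero_pair (μ := μ) (by lia)
  have h₃ := hT.lcs_three_ne_bot hM
  have h₂ := ne_bot_of_le_ne_bot h₃ (antitone_lcs μ (Nat.le_succ 2))
  have hz := hg.one_of_pair hT.1
  have hfin₂ := hz.finrank_le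
  have hlt₁ := hN.finrank_lcs_succ_lt (ne_bot_of_le_ne_bot h₂ (antitone_lcs μ (Nat.le_succ 1)))
  have hlt₂ := hN.finrank_lcs_succ_lt h₂
  have hlt₃ := hN.finrank_lcs_succ_lt h₃
  rcases le_or_gt (Module.finrank ℂ (lcs μ 3)) 1 with hfin₃ | hfin₃
  · have h₄ : lcs μ 4 = ⊥ := Submodule.finrank_eq_zero.mp (by lia)
    obtain ⟨u, hu, hu₀⟩ := (Submodule.ne_bot_iff _).mp h₃
    obtain ⟨M, hiso⟩ := exists_isomorphic_form hT hV hg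
      (spansLcs_singleton_of_ne_zero hu hu₀ h₄ hfin₃) h₄
    exact hiso.isListed (isListed_form fun h => hM (hiso.isMalcev h))
  · have hxy : ¬ (μ x (μ x y) ∈ lcs μ 3 ∧ μ y (μ x y) ∈ lcs μ 3) := fun ⟨hxz, hyz⟩ =>
      h₂ (hN.lcs_eq_bot_of_le ((hg.succ_pair hz fun a ha b hb => hT.mul_mem_lcs_three ha hb).lcs_le
        (Set.pair_subset hxz hyz) le_rfl))
    obtain ⟨x', y', hspan, -, hw, hyz⟩ := hz.exists_span_pair_eq hT.1 (by lia) hxy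
    have hg' := hg.zero_of_span_le hspan.ge
    by_cases h₄ : lcs μ 4 = ⊥
    · obtain ⟨a, b, hiso⟩ := exists_isomorphic_plane hT hV hg' hw hyz h₄
      exact hiso.isListed (isListed_plane a b)
    · have hlt₄ := hN.finrank_lcs_succ_lt h₄
      exact isListed_of_lcs_five_eq_bot hT hN hM hV hg' hw hyz h₄
        (Submodule.finrank_eq_zero.mp (by lia)) (by lia) (by lia)

end TwoGenerators

theorem isListed_of_finrank_eq_six {V : Type*} [AddCommGroup V] [Module ℂ V] {μ : Product V}
    (hT : IsTortkara μ) (hN : IsNilpotent μ) (hM : ¬ IsMalcev μ)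
    (hV : Module.finrank ℂ V = 6) : IsListed μ := by
  have : FiniteDimensional ℂ V := Module.finite_of_finrank_pos (by lia)
  rcases le_or_gt (Module.finrank ℂ (lcs μ 1)) 3 with hfin₁ | hfin₁
  · exact isListed_of_finrank_lcs_one_le_three hT hN hM hV hfin₁
  · have h₁ := ne_bot_of_le_ne_bot (hT.lcs_three_ne_bot hM) (antitone_lcs μ (by lia : 1 ≤ 3))
    have hcodim := finrank_lcs_one_add_two_le hT.1 hN h₁
    exact isListed_of_finrank_lcs_one_eq_four hT hN hM hV (by lia)

end Tortkara

theorem mainTheorem1 :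
    -- every algebra of the list is a (6-dimensional) nilpotent non-Malcev Tortkara algebra
    (∀ N : Tortkara.Name, Tortkara.IsTortkara N.product ∧ Tortkara.IsNilpotent N.product ∧
      ¬ Tortkara.IsMalcev N.product) ∧
    -- the list is complete
    (∀ (V : Type*) [AddCommGroup V] [Module ℂ V] (μ : Tortkara.Product V),
      Module.finrank ℂ V = 6 → Tortkara.IsTortkara μ → Tortkara.IsNilpotent μ →
      ¬ Tortkara.IsMalcev μ →
      ∃ N : Tortkara.Name, N.Nondegenerate ∧ Tortkara.Isomorphic μ N.product) ∧
    -- the only isomorphisms between algebras of the list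
    (∀ N N' : Tortkara.Name, N.Nondegenerate → N'.Nondegenerate →
      (Tortkara.Isomorphic N.product N'.product ↔
        N = N' ∨ ∃ α : ℂ, N = .T09 α ∧ N' = .T09 (-α - 1))) ∧
    -- the degenerate parameter values
    (Tortkara.Isomorphic (Tortkara.Name.T09 0).product Tortkara.Name.T02.product ∧
      Tortkara.Isomorphic (Tortkara.Name.T09 (-1)).product Tortkara.Name.T02.product ∧
      Tortkara.Isomorphic (Tortkara.Name.T18 (-1)).product Tortkara.Name.T01.product) :=
  ⟨fun N => ⟨N.isTortkara_product, N.isNilpotent_product, N.not_isMalcev_product⟩,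
    fun _ _ _ _ hV hT hN hM => Tortkara.isListed_of_finrank_eq_six hT hN hM hV,
    fun _ _ hN hN' => Tortkara.isomorphic_product_iff hN hN',
    Tortkara.isomorphic_T09_zero_T02, Tortkara.isomorphic_T09_neg_one_T02,
    Tortkara.isomorphic_T18_neg_one_T01⟩
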